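/- Let $n\ge 1$, let $M$ be a closed oriented smooth manifold of dimension $2n$ with a Riemannian metric $g$, and let $\pi:F\to M$ be an oriented real vector bundle of rank $2n$ with a flat connection $\nabla$ and total space $\mathcal F$, oriented by oriented coordinates of $M$ followed by oriented linear fibre coordinates. Let $U_1,\dots,U_N$ be open coordinate charts covering $M$ such that: (a) over each $U_\alpha$ the bundle $F$ has a smooth $\nabla$-parallel frame; let $y_\alpha^1,\dots,y_\alpha^{2n}$ be the corresponding linear fibre coordinates on $\pi^{-1}(U_\alpha)$; (b) each $U_\alpha$ has smooth boundary $\partial U_\alpha$ (with $U_\alpha$ locally on one side of it), and the boundaries $\partial U_\alpha$ intersect completely transversally, i.e. at each point of $M$ the conormals of the boundaries through this point are linearly independent. Let $r_\alpha$ be the normal geodesic coordinate near $\partial U_\alpha$ (the signed $g$-distance to $\partial U_\alpha$, positive in $U_\alpha$). Let $\rho_\alpha\in C^\infty(M)$ satisfy $\operatorname{Supp}\rho_\alpha\subseteq\overline U_\alpha$, $\rho_\alpha>0$ on $U_\alpha$, and $\rho_\alpha=h(r_\alpha)$ on $\overline U_\alpha$ near $\partial U_\alpha$, where $h(t)=\exp(-1/t^2)$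 for $t>0$ and $h(0)=0$. Let ${\bf B}$ be the set of points of $M$ lying on $2n$ different boundaries. For $p\in{\bf B}$ let $\beta_1>\cdots>\beta_{2n}$ be the indices with $p\in\partial U_{\beta_i}$ and let $\alpha_1>\cdots>\alpha_{N_p}$ be the indices with $p\in U_{\alpha_j}$. Put ${\bf B}_+=\{p\in{\bf B}:\beta_{2n}>\alpha_1\}$. For each $p\in{\bf B}$ let $W_p$ be an open neighbourhood of $p$ such that $\overline W_p\subset\bigcap_j U_{\alpha_j}$, $\rho_{\alpha_j}=1$ on $W_p$ for all $j$, $\overline W_p\cap\overline U_\alpha=\emptyset$ for every $\alpha$ not among the $\alpha_j$ and $\beta_i$, and $\overline W_p\cap\overline W_q=\emptyset$ for distinct $p,q\in{\bf B}$. Then for every $p\in{\bf B}_+$ there are an open neighbourhood $V_p\subset W_p$ of $p$ and a real number $\nu_p$ such that for every $\phi\in C^\infty(M)$ supported in $V_p$ with $\phi=1$ near $p$, the following integrals converge absolutely for all $T>0$ and $$\nu_p=\lim_{T\to+\infty}\int_{\mathcal F}\phi\,\prod_{i=1}^{2n}\left(\frac{d\rho_{\beta_i}\,T^{\beta_i}}{4\pi}\wedge\sum_{j=1}^{2n}d\big((y_{\beta_i}^j)^2\big)\right)\exp\left(-\sum_{i,j=1}^{2n}\rho_{\beta_i}T^{\beta_i}(y_{\beta_i}^j)^2-T^{\alpha_1}\sum_{j=1}^{2n}(y_{\alpha_1}^j)^2\right).$$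 Here functions and forms on $M$ are lifted to $\mathcal F$ by $\pi$, and terms containing $\rho_{\beta_i}$ or $d\rho_{\beta_i}$ are read as $0$ outside $\pi^{-1}(U_{\beta_i})$, where $\rho_{\beta_i}$ and $d\rho_{\beta_i}$ vanish. In particular $\nu_p$ does not depend on $\phi$. -/

import Mathlib

open Set Filter Topology MeasureTheory Bundle
open scoped Manifold ContDiff

noncomputable section

/-- Euclidean space of dimension `d`. -/
abbrev Eu (d : ℕ) : Type := EuclideanSpace ℝ (Fin d)

/-- The family `v` is a basis of the oriented vector space `(V, o)` and is positively oriented. -/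
def IsPositiveBasis {ι V : Type*} [Fintype ι] [DecidableEq ι] [AddCommGroup V] [Module ℝ V]
    (o : Orientation ℝ V ι) (v : ι → V) : Prop :=
  ∃ b : Module.Basis ι ℝ V, ⇑b = v ∧ b.orientation = o

/-- The wedge product `l 0 ∧ l 1 ∧ ⋯ ∧ l (m - 1)` of `m` linear forms,
normalised so that its value on `(w 0, …, w (m - 1))` is `det (l k (w j))`. -/
def wedgeForms {V : Type*} [AddCommGroup V] [Module ℝ V] {m : ℕ} (l : Fin m → V →ₗ[ℝ] ℝ) :
    V [⋀^Fin m]→ₗ[ℝ] ℝ :=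
  (Matrix.detRowAlternating : (Fin m → ℝ) [⋀^Fin m]→ₗ[ℝ] ℝ).compLinearMap (LinearMap.pi l)

/-- The basis `(∂/∂x¹, …, ∂/∂xᵈ, ∂/∂y¹, …, ∂/∂yᵈ)` of `ℝᵈ × ℝᵈ`, in this order. -/
def prodBasisVec (d : ℕ) : Fin (d * 2) → Eu d × Eu d :=
  Fin.append (fun i : Fin d => ((EuclideanSpace.single i (1 : ℝ), 0) : Eu d × Eu d))
    (fun j : Fin d => ((0, EuclideanSpace.single j (1 : ℝ)) : Eu d × Eu d)) ∘
    Fin.cast (Nat.mul_two d)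

/-- The function `h` with `h t = exp (-1 / t²)`, extended by its limit `h 0 = 0`. -/
def flatProfile (t : ℝ) : ℝ := if t = 0 then 0 else Real.exp (-1 / t ^ 2)

section Manifold

variable {d : ℕ} {M : Type*} [TopologicalSpace M] [ChartedSpace (Eu d) M]

variable (d M) in
/-- An orientation of the smooth `d`-manifold `M`: an orientation of each tangent space, such that
around each point there is a smooth chart all of whose coordinate bases are positive. -/
structure ManifoldOrientation where
  /-- the orientation of the tangent space at `x` -/
  at' : ∀ x : M, Orientation ℝ (TangentSpace (𝓡 d) x) (Fin d)
  exists_chart : ∀ x : M, ∃ e ∈ IsManifold.maximalAtlas (𝓡 d) ∞ M, x ∈ e.source ∧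
    ∀ a ∈ e.target, IsPositiveBasis (at' (e.symm a))
      (fun i => mfderiv (𝓡 d) (𝓡 d) e.symm a (EuclideanSpace.single i (1 : ℝ)))

/-- `r` is the normal geodesic coordinate near the boundary of `U` (for the metric `g`), counted
positively inside `U`: on an open neighbourhood `O` of `∂U` it is smooth, `U ∩ O = {r > 0}`,
`∂U ∩ O = {r = 0}`, and its `g`-gradient `u` is a unit vector field. The integral curves of the
gradient are then the unit-speed geodesics normal to `∂U`, so that near `∂U` the function `r` is
the signed `g`-distance to `∂U`. In particular `∂U` is a smooth hypersurface, `U` lies locally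
on one side of it, and `ker dr` is its tangent space. -/
def IsNormalGeodesicCoordinate
    [IsManifold (𝓡 d) ∞ M]
    (g : ContMDiffRiemannianMetric (𝓡 d) ∞ (Eu d) (fun x : M => TangentSpace (𝓡 d) x))
    (U : Set M) (r : M → ℝ) : Prop :=
  ∃ O : Set M, IsOpen O ∧ frontier U ⊆ O ∧ ContMDiffOn (𝓡 d) 𝓘(ℝ, ℝ) ∞ r O ∧
    (∀ x ∈ O, x ∈ U ↔ 0 < r x) ∧ (∀ x ∈ O, x ∈ frontier U ↔ r x = 0) ∧
    ∀ x ∈ O, ∃ u : TangentSpace (𝓡 d) x, g.inner x u u = 1 ∧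
      ∀ v : TangentSpace (𝓡 d) x, mvfderiv (𝓡 d) r x v = g.inner x u v

end Manifold

section Bundle

variable (d : ℕ) {M : Type*} [TopologicalSpace M] [ChartedSpace (Eu d) M]
  (F : M → Type*) [TopologicalSpace (TotalSpace (Eu d) F)]
  [∀ x, AddCommGroup (F x)] [∀ x, Module ℝ (F x)] [∀ x, TopologicalSpace (F x)]
  [FiberBundle (Eu d) F]

/-- An orientation of the rank `d` vector bundle `F`: an orientation of each fibre, such that
around each point there is a smooth local frame which is positive at every point. -/
structure BundleOrientation where
  /-- the orientation of the fibre over `x` -/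
  at' : ∀ x : M, Orientation ℝ (F x) (Fin d)
  exists_frame : ∀ x : M, ∃ (u : Set M) (s : Fin d → (y : M) → F y), IsOpen u ∧ x ∈ u ∧
    IsLocalFrameOn (𝓡 d) (Eu d) ∞ s u ∧ ∀ y ∈ u, IsPositiveBasis (at' y) (fun i => s i y)

/-- A differential form of top degree `2d` on the total space of `F` (no regularity required). -/
abbrev TopForm : Type _ :=
  ∀ v : TotalSpace (Eu d) F, (TangentSpace ((𝓡 d).prod 𝓘(ℝ, Eu d)) v) [⋀^Fin (d * 2)]→ₗ[ℝ] ℝ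

variable {d} {F}

/-- Positively oriented coordinates `(x, y)` on the total space of `F`: a positive smooth chart `x`
of `M` together with the linear fibre coordinates `y` of a positive smooth frame of `F` over its
domain. These coordinates define the orientation of the total space. -/
structure OrientedBundleChart (oM : ManifoldOrientation d M) (oF : BundleOrientation d F) where
  /-- the chart of the base -/
  chart : OpenPartialHomeomorph M (Eu d)
  chart_mem : chart ∈ IsManifold.maximalAtlas (𝓡 d) ∞ M
  chart_pos : ∀ a ∈ chart.target, IsPositiveBasis (oM.at' (chart.symm a))
    (fun i => mfderiv (𝓡 d) (𝓡 d) chart.symm a (EuclideanSpace.single i (1 : ℝ)))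
  /-- the frame of the bundle -/
  frame : Fin d → (x : M) → F x
  isLocalFrameOn : IsLocalFrameOn (𝓡 d) (Eu d) ∞ frame chart.source
  frame_pos : ∀ x ∈ chart.source, IsPositiveBasis (oF.at' x) (fun i => frame i x)

namespace OrientedBundleChart

variable {oM : ManifoldOrientation d M} {oF : BundleOrientation d F}

/-- The point of the total space with coordinates `z = (x, y)`, for `x` in the chart's target. -/
def param (B : OrientedBundleChart oM oF) (z : Eu d × Eu d) : TotalSpace (Eu d) F :=
  ⟨B.chart.symm z.1, ∑ j, z.2 j • B.frame j (B.chart.symm z.1)⟩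

/-- The coefficient `f` of `η = f dx¹ ∧ ⋯ ∧ dxᵈ ∧ dy¹ ∧ ⋯ ∧ dyᵈ` in the coordinates `(x, y)`. -/
def coeff (B : OrientedBundleChart oM oF) (η : TopForm d F) (z : Eu d × Eu d) : ℝ :=
  η (B.param z) (fun k => mfderiv 𝓘(ℝ, Eu d × Eu d) ((𝓡 d).prod 𝓘(ℝ, Eu d)) B.param z
    (prodBasisVec d k))

end OrientedBundleChart

/-- `∫ η = c`, for a form `η` of top degree on the oriented total space of `F`, with absolute
convergence: cut the total space into countably many disjoint measurable pieces `π⁻¹(A i)`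
(covering the support of `η`), each inside an oriented bundle chart, integrate the coordinate
expression of `η` over each piece, and sum up. By the change of variables formula neither the
convergence nor the value depends on the pieces and the oriented charts. -/
def HasFormIntegral (oM : ManifoldOrientation d M) (oF : BundleOrientation d F)
    (η : TopForm d F) (c : ℝ) : Prop :=
  ∃ (B : ℕ → OrientedBundleChart oM oF) (A : ℕ → Set M),
    (∀ i, MeasurableSet[borel M] (A i)) ∧ (∀ i, A i ⊆ (B i).chart.source) ∧
    (∀ i j, i ≠ j → Disjoint (A i) (A j)) ∧
    (∀ v : TotalSpace (Eu d) F, η v ≠ 0 → ∃ i, v.proj ∈ A i) ∧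
    (∀ i, IntegrableOn ((B i).coeff η) (((B i).chart '' A i) ×ˢ univ)) ∧
    Summable (fun i => ∫ z in ((B i).chart '' A i) ×ˢ univ, ‖(B i).coeff η z‖) ∧
    HasSum (fun i => ∫ z in ((B i).chart '' A i) ×ˢ univ, (B i).coeff η z) c

variable [∀ x, IsTopologicalAddGroup (F x)] [∀ x, ContinuousSMul ℝ (F x)]
  [IsManifold (𝓡 d) ∞ M]

/-- A transversal open covering `U 0, …, U (N - 1)` of `M` by coordinate charts with smooth
boundary, over each of which the connection `cov` has a parallel frame, together with cut-off
functions `ρ α`. (The existence of parallel frames near every point says that `cov` is a flat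
connection.) The ordering of the indices `α` matters. -/
structure TransversalCovering
    (g : ContMDiffRiemannianMetric (𝓡 d) ∞ (Eu d) (fun x : M => TangentSpace (𝓡 d) x))
    (cov : CovariantDerivative (𝓡 d) (Eu d) F) (N : ℕ) where
  /-- the coordinate chart `(U α, x_α)` -/
  chart : Fin N → OpenPartialHomeomorph M (Eu d)
  chart_mem : ∀ α, chart α ∈ IsManifold.maximalAtlas (𝓡 d) ∞ M
  covers : ⋃ α, (chart α).source = univ
  /-- the frame over `U α` that gives the identification of `F` with `U α × ℝᵈ` -/
  frame : Fin N → Fin d → (x : M) → F x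
  isLocalFrameOn : ∀ α, IsLocalFrameOn (𝓡 d) (Eu d) ∞ (frame α) (chart α).source
  parallel : ∀ α i, ∀ x ∈ (chart α).source, cov (frame α i) x = 0
  /-- the normal geodesic coordinate near the boundary of `U α` -/
  r : Fin N → M → ℝ
  isNormal : ∀ α, IsNormalGeodesicCoordinate g (chart α).source (r α)
  /-- at each point the boundaries through it have linearly independent conormals -/
  transversal : ∀ q : M, LinearIndependent ℝ
    (fun α : {α : Fin N // q ∈ frontier (chart α).source} => mvfderiv (𝓡 d) (r α) q)
  /-- the cut-off function of `U α` -/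
  ρ : Fin N → M → ℝ
  ρ_smooth : ∀ α, ContMDiff (𝓡 d) 𝓘(ℝ, ℝ) ∞ (ρ α)
  ρ_near : ∀ α, ∃ O : Set M, IsOpen O ∧ frontier (chart α).source ⊆ O ∧
    ∀ x ∈ O ∩ closure (chart α).source, ρ α x = flatProfile (r α x)
  ρ_support : ∀ α, tsupport (ρ α) ⊆ closure (chart α).source
  ρ_pos : ∀ α, ∀ x ∈ (chart α).source, 0 < ρ α x

namespace TransversalCovering

variable {g : ContMDiffRiemannianMetric (𝓡 d) ∞ (Eu d) (fun x : M => TangentSpace (𝓡 d) x)}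
  {cov : CovariantDerivative (𝓡 d) (Eu d) F} {N : ℕ}

/-- The open set `U α`. -/
def U (C : TransversalCovering g cov N) (α : Fin N) : Set M := (C.chart α).source

/-- The set of points that lie on `d` different boundaries. -/
def B (C : TransversalCovering g cov N) : Set M :=
  {p | {α | p ∈ frontier (C.U α)}.ncard = d}

/-- The points `p ∈ B` such that every index `β` with `p ∈ ∂U β` exceeds every index `α`
with `p ∈ U α`, i.e. the least such `β` exceeds the greatest such `α`. -/
def Bplus (C : TransversalCovering g cov N) : Set M :=
  {p ∈ C.B | ∀ α β, p ∈ C.U α → p ∈ frontier (C.U β) → α < β}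

/-- The open neighbourhoods `W p` of the points of `B`, as small as required throughout. -/
structure IsVertexNeighborhoods (C : TransversalCovering g cov N) (W : M → Set M) : Prop where
  isOpen : ∀ p ∈ C.B, IsOpen (W p)
  mem : ∀ p ∈ C.B, p ∈ W p
  closure_subset : ∀ p ∈ C.B, ∀ α, p ∈ C.U α → closure (W p) ⊆ C.U α
  disjoint : ∀ p ∈ C.B, ∀ q ∈ C.B, p ≠ q → Disjoint (closure (W p)) (closure (W q))
  ρ_eq_one : ∀ p ∈ C.B, ∀ α, p ∈ C.U α → ∀ x ∈ W p, C.ρ α x = 1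
  disjoint_other : ∀ p ∈ C.B, ∀ α, p ∉ C.U α → p ∉ frontier (C.U α) →
    Disjoint (closure (W p)) (closure (C.U α))

/-- The fibre coordinate `y_α^j` on `π⁻¹(U α)` (zero elsewhere). -/
def y (C : TransversalCovering g cov N) (α : Fin N) (j : Fin d) (v : TotalSpace (Eu d) F) : ℝ :=
  (C.isLocalFrameOn α).coeff j v.proj v.2

/-- `T` to the power of the index `α`, the indices being counted from `1` to `N`. -/
def pow (_C : TransversalCovering g cov N) (T : ℝ) (α : Fin N) : ℝ := T ^ ((α : ℕ) + 1)

/-- The pull-back to the total space of the `1`-form `dρ_α`. -/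
def dρ (C : TransversalCovering g cov N) (α : Fin N) (v : TotalSpace (Eu d) F) :
    TangentSpace ((𝓡 d).prod 𝓘(ℝ, Eu d)) v →ₗ[ℝ] ℝ :=
  (mvfderiv ((𝓡 d).prod 𝓘(ℝ, Eu d)) (fun w : TotalSpace (Eu d) F => C.ρ α w.proj) v).toLinearMap

/-- The `1`-form `∑ⱼ d((y_α^j)²)` on `π⁻¹(U α)`. -/
def dh (C : TransversalCovering g cov N) (α : Fin N) (v : TotalSpace (Eu d) F) :
    TangentSpace ((𝓡 d).prod 𝓘(ℝ, Eu d)) v →ₗ[ℝ] ℝ :=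
  ∑ j, (mvfderiv ((𝓡 d).prod 𝓘(ℝ, Eu d))
    (fun w : TotalSpace (Eu d) F => C.y α j w ^ 2) v).toLinearMap

/-- The form of top degree on the total space
`φ ∏ᵢ (dρ_{βᵢ} T^{βᵢ} / (4π) ∑ⱼ d(y_{βᵢ}^j)²)
  exp (-∑ᵢⱼ ρ_{βᵢ} T^{βᵢ} (y_{βᵢ}^j)² - T^{α₁} ∑ⱼ (y_{α₁}^j)²)`.
Outside `π⁻¹(U βᵢ)` the `i`-th factor is zero because `dρ_{βᵢ}` vanishes there. -/
def localForm (C : TransversalCovering g cov N) (α₁ : Fin N) (β : Fin d → Fin N) (φ : M → ℝ)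
    (T : ℝ) : TopForm d F := fun v =>
  (φ v.proj *
    Real.exp (-(∑ i, ∑ j, C.ρ (β i) v.proj * C.pow T (β i) * C.y (β i) j v ^ 2)
      - C.pow T α₁ * ∑ j, C.y α₁ j v ^ 2)) •
  wedgeForms (fun k : Fin (d * 2) =>
    if k.modNat = 0 then (C.pow T (β k.divNat) / (4 * Real.pi)) • C.dρ (β k.divNat) v
    else C.dh (β k.divNat) v)

end TransversalCovering

end Bundle

end

/-! ### Gaussian integrals of determinants of linear maps -/

section GaussianIntegrals

variable {d : ℕ}

/-! Near `p` take oriented coordinates `(a, y)` whose frame is, up to signs, the parallel frame over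
`U α₁`. Transition maps between parallel frames are locally constant, so on the connected corner
where all `ρ_{β i}` are positive one has `y_{β i} = G i y` with constant injective `G i`. Put `S i =
(G i)* (G i)`, `P = (ρ_{β i})`, `b i = β i + 1` and `m = α₁ + 1`. The coefficient of the form is
then a constant times `φ(a) ∏ T^{b i} det P'(a) det(S i y) exp(-∑ T^{b i} P_i(a) ⟨S i y, y⟩ - T^m
‖y‖²)`; see `exists_coeff_localForm_eq`.

Rescaling `y` by `T^{-m/2}` turns the fibre integral into a power of `T` times `K(t)`, where `t_i =
T^{b i - m} P_i(a)` and `K(t) = ∫ det(S i z) exp(-∑ t_i ⟨S i z, z⟩ - ‖z‖²) dz`. The remaining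
factors are exactly the Jacobian of `a ↦ t`, up to a constant orientation sign. Transversality and
the inverse function theorem make `P` injective on the corner, with an image containing all small
vectors of the open orthant. Since every `b i` exceeds `m`, the image in `t` exhausts the orthant as
`T → ∞`, and at fixed `t` the cut-off eventually equals 1. The limit is therefore a constant times
the integral of `K` over the orthant, whatever the cut-off.

What makes dominated convergence possible is the integrability of `K`. Homogeneity alone gives decay
of order `|t|^{-d}`, which just fails. But the integral without the term `‖z‖²` vanishes: up to a
constant factor the integrand is `dQ₁ ∧ ⋯ ∧ dQ_d · exp(-∑ t_i Q_i)` with `Q_i(z) = ⟨S i z, z⟩`, the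
differential of a rapidly decaying form (`integral_alternating_mul_exp_weightedForm_eq_zero`).
Subtracting it leaves a factor `exp(-‖z‖²) - 1`, of size at most `‖z‖²`, which gains one power of
`|t|` (`abs_gaussianTransform_le`). -/

lemma AlternatingMap.map_update_update_comm {V W ι : Type*} [AddCommGroup V] [Module ℝ V]
    [AddCommGroup W] [Module ℝ W] [DecidableEq ι] (Ω : V [⋀^ι]→ₗ[ℝ] W) (m : ι → V) {i j : ι}
    (hij : i ≠ j) (u v : V) :
    Ω (Function.update (Function.update m i v) j u)
      = -Ω (Function.update (Function.update m i u) j v) := by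
  rw [← Ω.map_swap _ hij]
  congr 1
  ext k
  by_cases hi : k = i
  · subst hi; simp [hij]
  by_cases hj : k = j
  · subst hj; simp [Function.update_of_ne hij]
  · simp [Equiv.swap_apply_of_ne_of_ne hi hj, hi, hj]

/-- The trace of a symmetric endomorphism against an alternating form vanishes. -/
lemma sum_alternating_symmetric_eq_zero {ι : Type*} [DecidableEq ι] (Ω : Eu d [⋀^ι]→ₗ[ℝ] ℝ)
    (S : Eu d →ₗ[ℝ] Eu d) (hS : S.IsSymmetric) (m : ι → Eu d) {i k : ι} (hik : i ≠ k) :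
    ∑ j, Ω (Function.update (Function.update m i (EuclideanSpace.single j 1)) k
      (S (EuclideanSpace.single j 1))) = 0 := by
  have hexp : ∀ j : Fin d, S (EuclideanSpace.single j 1)
      = ∑ l, (S (EuclideanSpace.single j 1)) l • (EuclideanSpace.single l (1 : ℝ) : Eu d) := by
    intro j
    ext a
    simp [Pi.single_apply]
  have hsym : ∀ j l : Fin d, (S (EuclideanSpace.single j 1)) l
      = (S (EuclideanSpace.single l 1)) j := by
    intro j l
    have := hS (EuclideanSpace.single j 1) (EuclideanSpace.single l 1)
    simpa [EuclideanSpace.inner_single_left, EuclideanSpace.inner_single_right] using this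
  have h1 : ∀ j : Fin d, Ω (Function.update (Function.update m i (EuclideanSpace.single j 1)) k
      (S (EuclideanSpace.single j 1)))
      = ∑ l, (S (EuclideanSpace.single j 1)) l •
        Ω (Function.update (Function.update m i (EuclideanSpace.single j 1)) k
          (EuclideanSpace.single l 1)) := by
    intro j
    conv_lhs => rw [hexp j]
    rw [AlternatingMap.map_update_sum]
    simp only [AlternatingMap.map_update_smul]
  simp only [h1]
  -- Exchanging the two summation indices preserves the symmetric coefficients and changes the sign
  -- of the alternating values.
  have h2 : ∀ X : ℝ, X = -X → X = 0 := fun X h => by linarith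
  apply h2
  conv_lhs => rw [Finset.sum_comm]
  rw [← Finset.sum_neg_distrib]
  refine Finset.sum_congr rfl fun j _ => ?_
  rw [← Finset.sum_neg_distrib]
  refine Finset.sum_congr rfl fun l _ => ?_
  rw [hsym l j, Ω.map_update_update_comm m hik, smul_neg]

lemma integrable_exp_neg_mul_sq_norm {c : ℝ} (hc : 0 < c) :
    Integrable (fun z : Eu d => Real.exp (-c * ‖z‖ ^ 2)) := by
  have := GaussianFourier.integrable_cexp_neg_mul_sq_norm_add (V := Eu d) (b := (c : ℂ))
    (by simpa using hc) 0 0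
  have h2 := this.re
  refine h2.congr (Eventually.of_forall fun z => ?_)
  simp only [inner_zero_left, Complex.ofReal_zero, mul_zero, add_zero]
  rw [show (-(c : ℂ) * (‖z‖ : ℂ) ^ 2) = ((-c * ‖z‖ ^ 2 : ℝ) : ℂ) by push_cast; ring,
    ← Complex.ofReal_exp]
  exact Complex.ofReal_re _

/-- Half of the Gaussian exponent absorbs the polynomial factor and the other half remains
integrable. -/
lemma integrable_pow_norm_mul_exp_neg {c : ℝ} (hc : 0 < c) (k : ℕ) :
    Integrable (fun z : Eu d => ‖z‖ ^ k * Real.exp (-c * ‖z‖ ^ 2)) := by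
  have hc2 : 0 < c / 2 := by positivity
  refine Integrable.mono' (((integrable_exp_neg_mul_sq_norm (d := d) hc2)).const_mul
    (1 + (k.factorial : ℝ) / (c / 2) ^ k)) (by fun_prop) (Eventually.of_forall fun z => ?_)
  rw [Real.norm_of_nonneg (by positivity)]
  -- Passing to powers of `‖z‖ ^ 2` allows comparison with a single term of the exponential series.
  have h1 : ‖z‖ ^ k ≤ 1 + (‖z‖ ^ 2) ^ k := by
    rcases le_total ‖z‖ 1 with h | h
    · have := pow_le_one₀ (norm_nonneg z) h (n := k)
      have : 0 ≤ (‖z‖ ^ 2) ^ k := by positivity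
      linarith
    · have : ‖z‖ ^ k ≤ (‖z‖ ^ 2) ^ k := by
        rw [← pow_mul]
        exact pow_le_pow_right₀ h (by omega)
      linarith
  have h2 := Real.pow_div_factorial_le_exp (c / 2 * ‖z‖ ^ 2) (by positivity) k
  have h3 : 1 ≤ Real.exp (c / 2 * ‖z‖ ^ 2) := Real.one_le_exp (by positivity)
  have h4 : ‖z‖ ^ k ≤ (1 + (k.factorial : ℝ) / (c / 2) ^ k) * Real.exp (c / 2 * ‖z‖ ^ 2) := by
    have : (‖z‖ ^ 2) ^ k ≤ (k.factorial : ℝ) / (c / 2) ^ k * Real.exp (c / 2 * ‖z‖ ^ 2) := by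
      rw [mul_pow, div_le_iff₀ (by positivity)] at h2
      rw [div_mul_eq_mul_div, le_div_iff₀ (by positivity)]
      linarith
    nlinarith
  calc ‖z‖ ^ k * Real.exp (-c * ‖z‖ ^ 2)
      ≤ ((1 + (k.factorial : ℝ) / (c / 2) ^ k) * Real.exp (c / 2 * ‖z‖ ^ 2))
        * Real.exp (-c * ‖z‖ ^ 2) := by gcongr
    _ = _ := by
      rw [mul_assoc, ← Real.exp_add]
      congr 2
      ring

/-- Substitution `z ↦ √s z`: the polynomial contributes `k` powers of `√s`, the volume element `d`
more. -/
lemma integral_pow_norm_mul_exp_neg {c s : ℝ} (hs : 0 < s) (k : ℕ) :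
    ∫ z : Eu d, ‖z‖ ^ k * Real.exp (-(c * s) * ‖z‖ ^ 2)
      = (√s ^ (k + d))⁻¹ * ∫ z : Eu d, ‖z‖ ^ k * Real.exp (-c * ‖z‖ ^ 2) := by
  have h := Measure.integral_comp_smul (volume : Measure (Eu d))
    (fun z => ‖z‖ ^ k * Real.exp (-c * ‖z‖ ^ 2)) (√s)
  have hs' : 0 < √s := Real.sqrt_pos.2 hs
  rw [finrank_euclideanSpace_fin, abs_of_pos (by positivity), smul_eq_mul] at h
  rw [pow_add, mul_inv, mul_assoc, ← h, ← integral_const_mul]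
  congr 1
  ext z
  rw [norm_smul, Real.norm_of_nonneg hs'.le, mul_pow, mul_pow, Real.sq_sqrt hs.le]
  field_simp

variable (Ω : Eu d [⋀^Fin d]→L[ℝ] ℝ) (S : Fin d → Eu d →L[ℝ] Eu d)

lemma abs_alternating_comp_le :
    ∃ C : ℝ, 0 ≤ C ∧ ∀ z : Eu d, |Ω (fun i => S i z)| ≤ C * ‖z‖ ^ d := by
  refine ⟨‖Ω‖ * ∏ i, ‖S i‖, by positivity, fun z => ?_⟩
  rw [← Real.norm_eq_abs]
  refine (Ω.le_opNorm _).trans ?_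
  rw [mul_assoc]
  gcongr
  calc ∏ i, ‖S i z‖ ≤ ∏ i, (‖S i‖ * ‖z‖) :=
        Finset.prod_le_prod (fun _ _ => norm_nonneg _) (fun i _ => (S i).le_opNorm z)
    _ = _ := by rw [Finset.prod_mul_distrib]; simp

@[fun_prop]
lemma continuous_alternating_comp : Continuous (fun z : Eu d => Ω (fun i => S i z)) :=
  Ω.cont.comp (continuous_pi fun i => (S i).continuous)

/-- The weighted quadratic form `∑ᵢ tᵢ ⟨Sᵢ z, z⟩`. -/
noncomputable def weightedForm (t z : Eu d) : ℝ := ∑ i, t i * inner ℝ (S i z) z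

lemma continuous_weightedForm :
    Continuous (fun p : Eu d × Eu d => weightedForm S p.1 p.2) := by
  unfold weightedForm
  fun_prop

variable {S}

/-- Uniform coercivity lets the single number `∑ i, t i` measure the size of the quadratic form. -/
lemma weightedForm_lower_bound {c : ℝ} (hc : ∀ i z, c * ‖z‖ ^ 2 ≤ inner ℝ (S i z) z)
    {t : Eu d} (ht : ∀ i, 0 ≤ t i) (z : Eu d) :
    c * (∑ i, t i) * ‖z‖ ^ 2 ≤ weightedForm S t z := by
  unfold weightedForm
  rw [Finset.mul_sum, Finset.sum_mul]
  refine Finset.sum_le_sum fun i _ => ?_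
  nlinarith [hc i z, ht i]

lemma hasFDerivAt_weightedForm (hS : ∀ i, (S i).toLinearMap.IsSymmetric) (t z : Eu d) :
    HasFDerivAt (weightedForm S t) (2 • innerSL ℝ (∑ i, t i • S i z)) z := by
  unfold weightedForm
  have h : ∀ i, HasFDerivAt (fun z => t i * inner ℝ (S i z) z)
      (t i • ((fderivInnerCLM ℝ (S i z, z)).comp ((S i).prod (ContinuousLinearMap.id ℝ _)))) z :=
    fun i => (((S i).hasFDerivAt).inner ℝ (hasFDerivAt_id z)).const_mul (t i)
  refine (HasFDerivAt.fun_sum fun i _ => h i).congr_fderiv ?_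
  ext v
  simp only [sum_apply, smul_apply,
    ContinuousLinearMap.comp_apply, ContinuousLinearMap.prod_apply, fderivInnerCLM_apply,
    ContinuousLinearMap.id_apply, innerSL_apply_apply, sum_inner, inner_smul_left, smul_eq_mul,
    nsmul_eq_mul, Nat.cast_ofNat]
  rw [Finset.mul_sum]
  refine Finset.sum_congr rfl fun i _ => ?_
  have := hS i v z
  simp only [ContinuousLinearMap.coe_coe] at this
  rw [this, real_inner_comm v]
  simp
  ring

/-- The slot `i₀` holds a constant vector, so the product rule has no term there. These derivatives
assemble into the divergence of the vector field used for integration by parts. -/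
lemma hasFDerivAt_alternating_update (Ω : Eu d [⋀^Fin d]→L[ℝ] ℝ) (i₀ : Fin d) (u z v : Eu d) :
    ∃ L : Eu d →L[ℝ] ℝ,
      HasFDerivAt (fun z => Ω (Function.update (fun i => S i z) i₀ u)) L z ∧
      L v = ∑ i ∈ Finset.univ.erase i₀,
        Ω (Function.update (Function.update (fun i => S i z) i₀ u) i (S i v)) := by
  have h := HasFDerivAt.multilinear_comp (𝕜 := ℝ) Ω.toContinuousMultilinearMap
    (g := fun i z => Function.update (fun i => S i z) i₀ u i)
    (g' := fun i => Function.update S i₀ 0 i) (x := z) (by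
      intro i
      by_cases hi : i = i₀
      · subst hi
        simpa using hasFDerivAt_const u z
      · simpa [hi] using (S i).hasFDerivAt)
  refine ⟨_, h, ?_⟩
  rw [sum_apply, ← Finset.add_sum_erase _ _ (Finset.mem_univ i₀)]
  have h0 : Ω.toContinuousMultilinearMap
      (Function.update (Function.update (fun i => S i z) i₀ u) i₀ 0) = 0 :=
    Ω.toContinuousMultilinearMap.map_update_zero _ i₀
  simp only [ContinuousLinearMap.comp_apply, Function.update_self,
    ContinuousMultilinearMap.toContinuousLinearMap_apply, zero_apply]
  rw [h0, zero_add]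
  refine Finset.sum_congr rfl fun i hi => ?_
  rw [Function.update_of_ne (Finset.ne_of_mem_erase hi)]
  rfl

/-- The exponent `e i` is 0 for a slot holding a constant vector and 1 for a slot linear in `z`, so
one bound serves all the updated families. -/
lemma abs_alternating_update_le (Ω : Eu d [⋀^Fin d]→L[ℝ] ℝ) (m : Eu d → Fin d → Eu d)
    {k : ℕ} (e : Fin d → ℕ) (C : Fin d → ℝ)
    (h : ∀ z i, ‖m z i‖ ≤ C i * ‖z‖ ^ e i) (hk : ∑ i, e i = k) (z : Eu d) :
    |Ω (m z)| ≤ (‖Ω‖ * ∏ i, C i) * ‖z‖ ^ k := by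
  rw [← Real.norm_eq_abs]
  refine (Ω.le_opNorm _).trans ?_
  rw [mul_assoc]
  gcongr
  calc ∏ i, ‖m z i‖ ≤ ∏ i, (C i * ‖z‖ ^ e i) :=
        Finset.prod_le_prod (fun _ _ => norm_nonneg _) (fun i _ => h z i)
    _ = _ := by rw [Finset.prod_mul_distrib, Finset.prod_pow_eq_pow_sum, hk]

lemma integrable_mul_exp_weightedForm {c : ℝ} (hc0 : 0 < c)
    (hc : ∀ i z, c * ‖z‖ ^ 2 ≤ inner ℝ (S i z) z) {t : Eu d} (ht : ∀ i, 0 ≤ t i)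
    (hs : 0 < ∑ i, t i) {g : Eu d → ℝ} (hg : Continuous g) {C : ℝ} {k : ℕ}
    (hgb : ∀ z, |g z| ≤ C * ‖z‖ ^ k) :
    Integrable (fun z => g z * Real.exp (-weightedForm S t z)) := by
  have hcont : Continuous (weightedForm S t) :=
    (continuous_weightedForm S).comp (Continuous.prodMk_right t)
  refine Integrable.mono' ((integrable_pow_norm_mul_exp_neg (d := d)
    (c := c * ∑ i, t i) (by positivity) k).const_mul C) (by fun_prop)
    (Eventually.of_forall fun z => ?_)
  rw [norm_mul, Real.norm_eq_abs, Real.norm_of_nonneg (Real.exp_pos _).le, ← mul_assoc]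
  have h1 := weightedForm_lower_bound hc ht z
  have h2 := hgb z
  have h3 : 0 ≤ C * ‖z‖ ^ k := (abs_nonneg _).trans h2
  have h4 : Real.exp (-weightedForm S t z) ≤ Real.exp (-(c * ∑ i, t i) * ‖z‖ ^ 2) :=
    Real.exp_le_exp.2 (by linarith)
  exact mul_le_mul h2 h4 (Real.exp_pos _).le h3

/-- The pull-back of a top-degree form under a map `(Q₁, …, Q_d)` of quadratic forms integrates
to zero against `exp (-∑ tᵢ Qᵢ)`. -/
lemma integral_alternating_mul_exp_weightedForm_eq_zero (Ω : Eu d [⋀^Fin d]→L[ℝ] ℝ)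
    (hS : ∀ i, (S i).toLinearMap.IsSymmetric) {c : ℝ} (hc0 : 0 < c)
    (hc : ∀ i z, c * ‖z‖ ^ 2 ≤ inner ℝ (S i z) z) {t : Eu d} (ht : ∀ i, 0 ≤ t i)
    (hs : 0 < ∑ i, t i) :
    ∫ z, Ω (fun i => S i z) * Real.exp (-weightedForm S t z) = 0 := by
  -- The integration by parts takes place in one slot of positive weight; the identity is divided by
  -- that weight at the end.
  obtain ⟨i₀, -, hi₀⟩ : ∃ i ∈ Finset.univ, 0 < t i := by
    by_contra! h
    exact hs.not_ge (Finset.sum_nonpos h)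
  set e : Fin d → Eu d := fun j => EuclideanSpace.single j 1 with he
  -- The `g j` are the components of a vector field, `g'` its partial derivatives, and the total
  -- divergence of `f • g` will be integrated.
  set g : Fin d → Eu d → ℝ := fun j z => Ω (Function.update (fun i => S i z) i₀ (e j)) with hg
  set g' : Fin d → Eu d → ℝ := fun j z => ∑ i ∈ Finset.univ.erase i₀,
        Ω (Function.update (Function.update (fun i => S i z) i₀ (e j)) i (S i (e j))) with hg'
  set f : Eu d → ℝ := fun z => Real.exp (-weightedForm S t z) with hf
  set A : Eu d → Eu d := fun z => ∑ i, t i • S i z with hA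
  have hAc : Continuous A := by fun_prop
  have hgc : ∀ j, Continuous (g j) := by
    intro j
    refine Ω.cont.comp (continuous_pi fun i => ?_)
    by_cases hi : i = i₀
    · subst hi; simpa using continuous_const
    · simpa [hi] using (S i).continuous
  have hgc' : ∀ j, Continuous (g' j) := by
    intro j
    refine continuous_finsetSum _ fun k hk => Ω.cont.comp (continuous_pi fun i => ?_)
    by_cases hik : i = k
    · subst hik; simpa using continuous_const
    by_cases hi : i = i₀
    · subst hi; simpa [hik] using continuous_const
    · simpa [hi, hik] using (S i).continuous
  have hgb : ∀ j, ∃ C, ∀ z, |g j z| ≤ C * ‖z‖ ^ (∑ i, if i = i₀ then 0 else 1) := by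
    intro j
    refine ⟨_, fun z => abs_alternating_update_le Ω
      (fun z => Function.update (fun i => S i z) i₀ (e j))
      (fun i => if i = i₀ then 0 else 1) (fun i => if i = i₀ then ‖e j‖ else ‖S i‖) ?_ rfl z⟩
    · intro z i
      by_cases hi : i = i₀
      · subst hi; simp
      · simpa [hi] using (S i).le_opNorm z
  have hgb' : ∀ j, ∀ k ∈ Finset.univ.erase i₀, ∃ C, ∀ z,
      |Ω (Function.update (Function.update (fun i => S i z) i₀ (e j)) k (S k (e j)))|
        ≤ C * ‖z‖ ^ (∑ i, if i = i₀ ∨ i = k then 0 else 1) := by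
    intro j k hk
    refine ⟨_, fun z => abs_alternating_update_le Ω
      (fun z => Function.update (Function.update (fun i => S i z) i₀ (e j)) k (S k (e j)))
      (fun i => if i = i₀ ∨ i = k then 0 else 1)
      (fun i => if i = k then ‖S k (e j)‖ else if i = i₀ then ‖e j‖ else ‖S i‖) ?_ rfl z⟩
    · intro z i
      by_cases hik : i = k
      · subst hik; simp
      by_cases hi : i = i₀
      · subst hi; simp [hik]
      · simpa [hi, hik] using (S i).le_opNorm z
  have hint : ∀ j, Integrable (fun z => g j z * f z) := by
    intro j
    obtain ⟨C, hC⟩ := hgb j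
    exact integrable_mul_exp_weightedForm hc0 hc ht hs (hgc j) hC
  have hint' : ∀ j, Integrable (fun z => g' j z * f z) := by
    intro j
    simp only [hg', Finset.sum_mul]
    refine integrable_finsetSum _ fun k hk => ?_
    obtain ⟨C, hC⟩ := hgb' j k hk
    refine integrable_mul_exp_weightedForm hc0 hc ht hs ?_ hC
    refine Ω.cont.comp (continuous_pi fun i => ?_)
    by_cases hik : i = k
    · subst hik; simpa using continuous_const
    by_cases hi : i = i₀
    · subst hi; simpa [hik] using continuous_const
    · simpa [hi, hik] using (S i).continuous
  have hint'' : ∀ j, Integrable (fun z => (-(2 * inner ℝ (A z) (e j)) * g j z) * f z) := by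
    intro j
    obtain ⟨C, hC⟩ := hgb j
    refine integrable_mul_exp_weightedForm hc0 hc ht hs
      (k := 1 + ∑ i, if i = i₀ then 0 else 1) (C := (2 * (∑ i, ‖t i • S i‖)) * C) (by fun_prop) ?_
    intro z
    rw [abs_mul, pow_add, pow_one, mul_mul_mul_comm]
    refine mul_le_mul ?_ (hC z) (abs_nonneg _) (by positivity)
    rw [abs_neg, abs_mul, abs_of_pos (zero_lt_two' ℝ), mul_assoc]
    gcongr
    refine (abs_real_inner_le_norm _ _).trans ?_
    have : ‖e j‖ = 1 := by simp [he]
    rw [this, mul_one, Finset.sum_mul]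
    exact (norm_sum_le _ _).trans (Finset.sum_le_sum fun i _ => (t i • S i).le_opNorm z)
  have hfd : ∀ z j, HasLineDerivAt ℝ f (f z * -(2 * inner ℝ (A z) (e j))) z (e j) := by
    intro z j
    have := ((hasFDerivAt_weightedForm hS t z).neg.exp).hasLineDerivAt (e j)
    convert! this using 1
    simp [hf, hA, sum_inner, inner_smul_left]
  have hgd : ∀ z j, HasLineDerivAt ℝ (g j) (g' j z) z (e j) := by
    intro z j
    obtain ⟨L, hL, hL2⟩ := hasFDerivAt_alternating_update (S := S) Ω i₀ (e j) z (e j)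
    have := hL.hasLineDerivAt (e j)
    rw [hL2] at this
    exact this
  have hparts : ∀ j, ∫ z, f z * g' j z = -∫ z, (f z * -(2 * inner ℝ (A z) (e j))) * g j z := by
    intro j
    refine integral_bilinear_hasLineDerivAt_right_eq_neg_left_of_integrable
      (B := ContinuousLinearMap.mul ℝ ℝ) (v := e j) ?_ ?_ ?_ (fun z _ => hfd z j)
      (fun z _ => hgd z j)
    · refine (hint'' j).congr (Eventually.of_forall fun z => ?_)
      simp only [ContinuousLinearMap.mul_apply']
      ring
    · simpa [mul_comm] using hint' j
    · simpa [mul_comm] using hint j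
  -- The field `g` is divergence-free. Each summand is the trace of a symmetric map against an
  -- alternating form; this is closedness of the differentials of the quadratic forms.
  have hsum' : ∀ z, ∑ j, f z * g' j z = 0 := by
    intro z
    rw [← Finset.mul_sum]
    simp only [hg']
    rw [Finset.sum_comm, Finset.sum_eq_zero, mul_zero]
    intro k hk
    exact sum_alternating_symmetric_eq_zero Ω.toAlternatingMap (S k).toLinearMap (hS k) _
      (Finset.ne_of_mem_erase hk).symm
  -- Differentiating the Gaussian along `g` puts the gradient `∑ t i • S i z` into slot `i₀`, which
  -- recovers the original integrand.
  have hsum : ∀ z, ∑ j, (f z * -(2 * inner ℝ (A z) (e j))) * g j z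
      = -(2 * t i₀) * (Ω (fun i => S i z) * f z) := by
    intro z
    have h1 : ∑ j, inner ℝ (A z) (e j) * g j z = Ω (Function.update (fun i => S i z) i₀ (A z)) := by
      have : A z = ∑ j, inner ℝ (A z) (e j) • e j := by
        ext a
        simp [he, EuclideanSpace.inner_single_right, Pi.single_apply]
      conv_rhs => rw [this]
      have h2 := Ω.toAlternatingMap.map_update_sum Finset.univ i₀
        (fun j => inner ℝ (A z) (e j) • e j) (fun i => S i z)
      refine Eq.trans ?_ h2.symm
      refine Finset.sum_congr rfl fun j _ => ?_
      exact (Ω.toAlternatingMap.map_update_smul (fun i => S i z) i₀ _ (e j)).symm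
    have h2 : Ω (Function.update (fun i => S i z) i₀ (A z)) = t i₀ * Ω (fun i => S i z) := by
      have h2 := Ω.toAlternatingMap.map_update_sum Finset.univ i₀
        (fun i => t i • S i z) (fun i => S i z)
      refine Eq.trans h2 ?_
      -- For `k ≠ i₀` the vector `S k z` occurs in two slots.
      rw [Finset.sum_eq_single i₀]
      · rw [Ω.toAlternatingMap.map_update_smul, smul_eq_mul]
        congr 1
        rw [Function.update_eq_self]
        rfl
      · intro k _ hk
        rw [Ω.toAlternatingMap.map_update_smul, Ω.toAlternatingMap.map_update_self _ hk.symm,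
          smul_zero]
      · simp
    rw [show -(2 * t i₀) * (Ω (fun i => S i z) * f z) = f z * -2 * (t i₀ * Ω (fun i => S i z)) by
      ring, ← h2, ← h1, Finset.mul_sum]
    refine Finset.sum_congr rfl fun j _ => by ring
  have hfin : ∫ z, ∑ j, f z * g' j z = -∫ z, ∑ j, (f z * -(2 * inner ℝ (A z) (e j))) * g j z := by
    rw [integral_finsetSum, integral_finsetSum, ← Finset.sum_neg_distrib]
    · exact Finset.sum_congr rfl fun j _ => hparts j
    · intro j _
      refine (hint'' j).congr (Eventually.of_forall fun z => ?_)
      ring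
    · intro j _
      simpa [mul_comm] using hint' j
  simp only [hsum', hsum, integral_zero, integral_const_mul] at hfin
  have : 2 * t i₀ ≠ 0 := by positivity
  have h0 : (2 * t i₀) * ∫ z, Ω (fun i => S i z) * f z = 0 := by linarith
  exact (mul_eq_zero.1 h0).resolve_left this

/-! ### Decay and integrability of the Gaussian transform -/

variable (S) in
/-- The Gaussian integral `∫ Ω(S₁ z, …, S_d z) exp (-∑ tᵢ ⟨Sᵢ z, z⟩ - ‖z‖²) dz`. -/
noncomputable def gaussianTransform (Ω : Eu d [⋀^Fin d]→L[ℝ] ℝ) (t : Eu d) : ℝ :=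
  ∫ z, Ω (fun i => S i z) * Real.exp (-weightedForm S t z - ‖z‖ ^ 2)

lemma norm_le_sum_coord {t : Eu d} (ht : ∀ i, 0 ≤ t i) : ‖t‖ ≤ ∑ i, t i := by
  have h : t = ∑ i, t i • (EuclideanSpace.single i (1 : ℝ) : Eu d) := by
    ext a
    simp [Pi.single_apply]
  calc ‖t‖ = ‖∑ i, t i • (EuclideanSpace.single i (1 : ℝ) : Eu d)‖ := by rw [← h]
    _ ≤ ∑ i, ‖t i • (EuclideanSpace.single i (1 : ℝ) : Eu d)‖ := norm_sum_le _ _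
    _ = ∑ i, t i := by
      refine Finset.sum_congr rfl fun i _ => ?_
      rw [norm_smul, Real.norm_of_nonneg (ht i)]
      simp

lemma weightedForm_nonneg {c : ℝ} (hc0 : 0 < c) (hc : ∀ i z, c * ‖z‖ ^ 2 ≤ inner ℝ (S i z) z)
    {t : Eu d} (ht : ∀ i, 0 ≤ t i) (z : Eu d) : 0 ≤ weightedForm S t z :=
  le_trans (mul_nonneg (mul_nonneg hc0.le (Finset.sum_nonneg fun i _ => ht i)) (sq_nonneg _))
    (weightedForm_lower_bound hc ht z)

/-- Discarding the nonnegative weighted form leaves a Gaussian independent of `t`. This controls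
small `t`. -/
lemma abs_gaussianTransform_le_const (Ω : Eu d [⋀^Fin d]→L[ℝ] ℝ) {c : ℝ} (hc0 : 0 < c)
    (hc : ∀ i z, c * ‖z‖ ^ 2 ≤ inner ℝ (S i z) z) {C₁ : ℝ} (hC₁ : 0 ≤ C₁)
    (hb : ∀ z : Eu d, |Ω (fun i => S i z)| ≤ C₁ * ‖z‖ ^ d) {t : Eu d} (ht : ∀ i, 0 ≤ t i) :
    |gaussianTransform S Ω t| ≤ C₁ * (∫ z : Eu d, ‖z‖ ^ d * Real.exp (-1 * ‖z‖ ^ 2)) := by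
  rw [← Real.norm_eq_abs, gaussianTransform, ← integral_const_mul]
  refine norm_integral_le_of_norm_le
    ((integrable_pow_norm_mul_exp_neg one_pos d).const_mul C₁) (Eventually.of_forall fun z => ?_)
  rw [norm_mul, Real.norm_eq_abs, Real.norm_of_nonneg (Real.exp_pos _).le, ← mul_assoc]
  refine mul_le_mul (hb z) (Real.exp_le_exp.2 ?_) (Real.exp_pos _).le (by positivity)
  have := weightedForm_nonneg hc0 hc ht z
  linarith

/-- Subtracting the vanishing integral replaces `exp (-‖z‖ ^ 2)` by its difference from 1, bounded
by `‖z‖ ^ 2`. The two additional powers of `‖z‖` become one additional inverse power of `∑ i, t i`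
after scaling, lifting the decay past the dimension `d`. -/
lemma abs_gaussianTransform_le_inv_pow_sum (Ω : Eu d [⋀^Fin d]→L[ℝ] ℝ)
    (hS : ∀ i, (S i).toLinearMap.IsSymmetric) {c : ℝ} (hc0 : 0 < c)
    (hc : ∀ i z, c * ‖z‖ ^ 2 ≤ inner ℝ (S i z) z) {C₁ : ℝ} (hC₁ : 0 ≤ C₁)
    (hb : ∀ z : Eu d, |Ω (fun i => S i z)| ≤ C₁ * ‖z‖ ^ d) {t : Eu d} (ht : ∀ i, 0 ≤ t i)
    (hs : 0 < ∑ i, t i) :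
    |gaussianTransform S Ω t| ≤ C₁ * (∫ z : Eu d, ‖z‖ ^ (d + 2) * Real.exp (-c * ‖z‖ ^ 2)) * ((∑ i, t i) ^ (d + 1))⁻¹ := by
  have hcont : Continuous (weightedForm S t) :=
    (continuous_weightedForm S).comp (Continuous.prodMk_right t)
  have h0 := integral_alternating_mul_exp_weightedForm_eq_zero Ω hS hc0 hc ht hs
  have hi := integrable_mul_exp_weightedForm hc0 hc ht hs (continuous_alternating_comp Ω S) hb
  have hi2 : Integrable (fun z => Ω (fun i => S i z) *
      Real.exp (-weightedForm S t z - ‖z‖ ^ 2)) := by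
    refine hi.mono (by fun_prop) (Eventually.of_forall fun z => ?_)
    rw [norm_mul, norm_mul, Real.norm_of_nonneg (Real.exp_pos _).le,
      Real.norm_of_nonneg (Real.exp_pos _).le]
    gcongr
    have := sq_nonneg ‖z‖
    linarith
  have h1 : gaussianTransform S Ω t = ∫ z, (Ω (fun i => S i z) *
      Real.exp (-weightedForm S t z - ‖z‖ ^ 2)
      - Ω (fun i => S i z) * Real.exp (-weightedForm S t z)) := by
    rw [integral_sub hi2 hi, h0, sub_zero, gaussianTransform]
  have h2 : ((∑ i, t i) ^ (d + 1))⁻¹ = (√(∑ i, t i) ^ (d + 2 + d))⁻¹ := by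
    rw [show d + 2 + d = 2 * (d + 1) by ring, pow_mul, Real.sq_sqrt hs.le]
  rw [mul_assoc, mul_comm (∫ z : Eu d, _), h2, ← integral_pow_norm_mul_exp_neg hs, ← integral_const_mul,
    h1, ← Real.norm_eq_abs]
  refine norm_integral_le_of_norm_le ((integrable_pow_norm_mul_exp_neg
    (by positivity) _).const_mul C₁) (Eventually.of_forall fun z => ?_)
  have h3 : Ω (fun i => S i z) * Real.exp (-weightedForm S t z - ‖z‖ ^ 2)
      - Ω (fun i => S i z) * Real.exp (-weightedForm S t z)
      = Ω (fun i => S i z) * (-((1 - Real.exp (-‖z‖ ^ 2)) * Real.exp (-weightedForm S t z))) := by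
    rw [sub_eq_add_neg (-weightedForm S t z), Real.exp_add]
    ring
  have h4 := Real.one_sub_le_exp_neg (‖z‖ ^ 2)
  have h5 : Real.exp (-‖z‖ ^ 2) ≤ 1 := Real.exp_le_one_iff.2 (by have := sq_nonneg ‖z‖; linarith)
  have h6 := weightedForm_lower_bound hc ht z
  have h7 : Real.exp (-weightedForm S t z) ≤ Real.exp (-(c * ∑ i, t i) * ‖z‖ ^ 2) :=
    Real.exp_le_exp.2 (by linarith)
  rw [h3, norm_mul, norm_neg, norm_mul, Real.norm_of_nonneg (Real.exp_pos _).le,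
    Real.norm_of_nonneg (by linarith : 0 ≤ 1 - Real.exp (-‖z‖ ^ 2)), Real.norm_eq_abs]
  calc _ ≤ (C₁ * ‖z‖ ^ d) * (‖z‖ ^ 2 * Real.exp (-(c * ∑ i, t i) * ‖z‖ ^ 2)) := by
        refine mul_le_mul (hb z) ?_ ?_ (by positivity)
        · exact mul_le_mul (by linarith) h7 (Real.exp_pos _).le (by positivity)
        · exact mul_nonneg (by linarith) (Real.exp_pos _).le
    _ = _ := by ring

/-- The constant bound is used for `∑ i, t i ≤ 1` and the decaying bound otherwise; both compare
with `1 + ‖t‖` since the Euclidean norm is at most the coordinate sum. -/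
lemma abs_gaussianTransform_le (Ω : Eu d [⋀^Fin d]→L[ℝ] ℝ)
    (hS : ∀ i, (S i).toLinearMap.IsSymmetric) {c : ℝ} (hc0 : 0 < c)
    (hc : ∀ i z, c * ‖z‖ ^ 2 ≤ inner ℝ (S i z) z) :
    ∃ C : ℝ, ∀ t : Eu d, (∀ i, 0 ≤ t i) →
      |gaussianTransform S Ω t| ≤ C * ((1 + ‖t‖) ^ (d + 1))⁻¹ := by
  obtain ⟨C₁, hC₁, hb⟩ := abs_alternating_comp_le Ω S
  obtain ⟨M₁, hM₁, hbound₁⟩ : ∃ M : ℝ, 0 ≤ M ∧ ∀ t : Eu d, (∀ i, 0 ≤ t i) →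
      |gaussianTransform S Ω t| ≤ C₁ * M := ⟨_, integral_nonneg fun z => by positivity,
    fun t ht => abs_gaussianTransform_le_const Ω hc0 hc hC₁ hb ht⟩
  obtain ⟨M₂, hM₂, hbound₂⟩ : ∃ M : ℝ, 0 ≤ M ∧ ∀ t : Eu d, (∀ i, 0 ≤ t i) → 0 < ∑ i, t i →
      |gaussianTransform S Ω t| ≤ C₁ * M * ((∑ i, t i) ^ (d + 1))⁻¹ :=
    ⟨_, integral_nonneg fun z => by positivity,
    fun t ht hs => abs_gaussianTransform_le_inv_pow_sum Ω hS hc0 hc hC₁ hb ht hs⟩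
  refine ⟨(C₁ * M₁ + C₁ * M₂) * 2 ^ (d + 1), fun t ht => ?_⟩
  have hn := norm_le_sum_coord ht
  have hn0 := norm_nonneg t
  rcases le_total (∑ i, t i) 1 with hs | hs
  · refine (hbound₁ t ht).trans ?_
    have : (1 + ‖t‖) ^ (d + 1) ≤ 2 ^ (d + 1) := by gcongr; linarith
    rw [← div_eq_mul_inv, le_div_iff₀ (by positivity)]
    have h8 : 0 ≤ C₁ * M₂ := by positivity
    have h9 : 0 ≤ C₁ * M₁ := by positivity
    refine mul_le_mul (by linarith) this (by positivity) (by positivity)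
  · refine (hbound₂ t ht (by linarith)).trans ?_
    have : (1 + ‖t‖) ^ (d + 1) ≤ 2 ^ (d + 1) * (∑ i, t i) ^ (d + 1) := by
      rw [← mul_pow]
      gcongr
      linarith
    have h8 : 0 ≤ C₁ * M₂ := by positivity
    have h9 : 0 ≤ C₁ * M₁ := by positivity
    have h10 : ((∑ i, t i) ^ (d + 1))⁻¹ ≤ 2 ^ (d + 1) * ((1 + ‖t‖) ^ (d + 1))⁻¹ := by
      rw [← div_eq_mul_inv, le_div_iff₀ (by positivity), inv_mul_le_iff₀ (by positivity)]
      linarith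
    rw [mul_assoc (C₁ * M₁ + C₁ * M₂)]
    exact mul_le_mul (by linarith) h10 (by positivity) (by positivity)

variable (S) in
lemma stronglyMeasurable_gaussianTransform (Ω : Eu d [⋀^Fin d]→L[ℝ] ℝ) :
    StronglyMeasurable (gaussianTransform S Ω) := by
  refine StronglyMeasurable.integral_prod_right (f := fun t z => Ω (fun i => S i z) *
    Real.exp (-weightedForm S t z - ‖z‖ ^ 2)) ?_
  refine Continuous.stronglyMeasurable ?_
  have h1 := (continuous_alternating_comp Ω S).comp (continuous_snd (X := Eu d))
  have h2 := continuous_weightedForm S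
  exact h1.mul ((h2.neg.sub (continuous_snd.norm.pow 2)).rexp)

variable (d) in
/-- The open positive orthant. -/
def posOrthant : Set (Eu d) := {t | ∀ i, 0 < t i}

variable (d) in
lemma isOpen_posOrthant : IsOpen (posOrthant d) := by
  simp only [posOrthant, ofPred_forall]
  exact isOpen_iInter_of_finite fun i => isOpen_lt continuous_const (by fun_prop)

/-- The exponent `d + 1` is strictly larger than the dimension, as integrability at infinity
requires. -/
lemma integrableOn_one_add_norm_inv_pow (s : Set (Eu d)) (C : ℝ) :
    IntegrableOn (fun t : Eu d => C * ((1 + ‖t‖) ^ (d + 1))⁻¹) s := by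
  have h := integrable_one_add_norm (E := Eu d) (μ := volume) (r := ((d + 1 : ℕ) : ℝ)) (by simp)
  refine ((h.const_mul C).congr (Eventually.of_forall fun t => ?_)).integrableOn
  simp only
  rw [Real.rpow_neg (by positivity), Real.rpow_natCast]

/-- Substitution `z = √b y`: the determinant and the volume element each contribute `√b ^ d`, hence
the factor `(b ^ d)⁻¹`, and the weights are divided by `b`. -/
lemma integral_alternating_mul_exp_eq (Ω : Eu d [⋀^Fin d]→L[ℝ] ℝ) {b : ℝ} (hb : 0 < b)
    (t : Eu d) :
    ∫ y, Ω (fun i => S i y) * Real.exp (-weightedForm S t y - b * ‖y‖ ^ 2)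
      = (b ^ d)⁻¹ * gaussianTransform S Ω (b⁻¹ • t) := by
  have h := Measure.integral_comp_smul (volume : Measure (Eu d))
    (fun z => Ω (fun i => S i z) * Real.exp (-weightedForm S (b⁻¹ • t) z - ‖z‖ ^ 2)) (√b)
  have hb' : 0 < √b := Real.sqrt_pos.2 hb
  have h1 : ∀ y : Eu d, Ω (fun i => S i (√b • y)) *
      Real.exp (-weightedForm S (b⁻¹ • t) (√b • y) - ‖√b • y‖ ^ 2)
      = √b ^ d * (Ω (fun i => S i y) * Real.exp (-weightedForm S t y - b * ‖y‖ ^ 2)) := by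
    intro y
    have e1 : Ω (fun i => S i (√b • y)) = √b ^ d * Ω (fun i => S i y) := by
      simp only [map_smul]
      have := Ω.toAlternatingMap.map_smul_univ (fun _ => √b) (fun i => S i y)
      simpa using this
    have e2 : weightedForm S (b⁻¹ • t) (√b • y) = weightedForm S t y := by
      unfold weightedForm
      refine Finset.sum_congr rfl fun i _ => ?_
      rw [map_smul, inner_smul_left, inner_smul_right]
      simp only [PiLp.smul_apply, smul_eq_mul, conj_trivial]
      rw [← mul_assoc √b, Real.mul_self_sqrt hb.le]
      field_simp
    rw [e1, e2, norm_smul, Real.norm_of_nonneg hb'.le, mul_pow, Real.sq_sqrt hb.le, mul_assoc]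
  simp only [h1] at h
  rw [integral_const_mul, finrank_euclideanSpace_fin, abs_of_pos (by positivity),
    smul_eq_mul] at h
  have h2 : b ^ d = √b ^ d * √b ^ d := by
    rw [← mul_pow, Real.mul_self_sqrt hb.le]
  rw [h2, gaussianTransform, mul_inv, mul_assoc, ← h]
  field_simp

end GaussianIntegrals

/-! ### The limit of the localised Gaussian integral -/

section LaplaceLimit

variable {d : ℕ}

/-- The diagonal endomorphism of Euclidean space with diagonal `l`. -/
noncomputable def diagonalScaling (l : Fin d → ℝ) : Eu d →L[ℝ] Eu d :=
  Matrix.toEuclideanCLM (𝕜 := ℝ) (Matrix.diagonal l)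

@[simp]
lemma diagonalScaling_apply (l : Fin d → ℝ) (x : Eu d) (i : Fin d) :
    diagonalScaling l x i = l i * x i := by
  simp [diagonalScaling, Matrix.mulVec_diagonal]

lemma det_diagonalScaling (l : Fin d → ℝ) : (diagonalScaling l).det = ∏ i, l i := by
  rw [ContinuousLinearMap.det,
    ← LinearMap.det_toMatrix (EuclideanSpace.basisFun (Fin d) ℝ).toBasis, ← Matrix.det_diagonal]
  congr 1
  ext i j
  rw [LinearMap.toMatrix_apply]
  simp [Matrix.diagonal_apply]

variable (S : Fin d → Eu d →L[ℝ] Eu d) (Ω : Eu d [⋀^Fin d]→L[ℝ] ℝ)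

lemma integrableOn_gaussianTransform (hS : ∀ i, (S i).toLinearMap.IsSymmetric) {c : ℝ}
    (hc0 : 0 < c) (hc : ∀ i z, c * ‖z‖ ^ 2 ≤ inner ℝ (S i z) z) :
    IntegrableOn (gaussianTransform S Ω) (posOrthant d) := by
  obtain ⟨C, hC⟩ := abs_gaussianTransform_le Ω hS hc0 hc
  refine Integrable.mono' (integrableOn_one_add_norm_inv_pow (posOrthant d) C)
    (stronglyMeasurable_gaussianTransform S Ω).aestronglyMeasurable ?_
  filter_upwards [ae_restrict_mem (isOpen_posOrthant d).measurableSet] with t ht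
  exact hC t fun i => (ht i).le

variable {X : Set (Eu d)} {P : Eu d → Eu d} {P' : Eu d → Eu d →L[ℝ] Eu d} {χ : Eu d → ℝ}

/-- Dominated convergence after the substitution `t = l(T) P(a)`. -/
lemma tendsto_integral_comp_diagonalScaling (hX : MeasurableSet X)
    (hP' : ∀ a ∈ X, HasFDerivWithinAt P (P' a) X a) (hinj : InjOn P X)
    (hpos : ∀ a ∈ X, P a ∈ posOrthant d)
    (hχm : AEStronglyMeasurable χ (volume.restrict X)) {Cχ : ℝ} (hχb : ∀ a ∈ X, |χ a| ≤ Cχ)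
    (hχ1 : ∀ᶠ s in 𝓝[posOrthant d] 0, ∃ a ∈ X, P a = s ∧ χ a = 1)
    {K : Eu d → ℝ} (hK : IntegrableOn K (posOrthant d))
    {l : ℝ → Fin d → ℝ} (hl0 : ∀ T, 0 < T → ∀ i, 0 < l T i)
    (hl : ∀ i, Tendsto (fun T => l T i) atTop atTop) :
    (∀ T, 0 < T → IntegrableOn
      (fun a => |(P' a).det| * (∏ i, l T i) * (χ a * K (diagonalScaling (l T) (P a)))) X) ∧
    Tendsto (fun T => ∫ a in X,
      |(P' a).det| * (∏ i, l T i) * (χ a * K (diagonalScaling (l T) (P a)))) atTop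
      (𝓝 (∫ t in posOrthant d, K t)) := by
  set Θ : ℝ → Eu d → Eu d := fun T a => diagonalScaling (l T) (P a) with hΘ
  have hΘ' : ∀ T, ∀ a ∈ X, HasFDerivWithinAt (Θ T) ((diagonalScaling (l T)).comp (P' a)) X a :=
    fun T a ha => (diagonalScaling (l T)).hasFDerivAt.comp_hasFDerivWithinAt a (hP' a ha)
  have hdet : ∀ T, 0 < T → ∀ a, |((diagonalScaling (l T)).comp (P' a)).det|
      = |(P' a).det| * (∏ i, l T i) := by
    intro T hT a
    have : ((diagonalScaling (l T)).comp (P' a)).det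
        = (diagonalScaling (l T)).det * (P' a).det := LinearMap.det_comp _ _
    rw [this, det_diagonalScaling, abs_mul, mul_comm,
      abs_of_pos (Finset.prod_pos fun i _ => hl0 T hT i)]
  have hδinj : ∀ T, 0 < T → Function.Injective (diagonalScaling (l T)) := by
    intro T hT x y hxy
    ext i
    have := congrArg (fun v : Eu d => v i) hxy
    simpa [(hl0 T hT i).ne'] using this
  have hΘinj : ∀ T, 0 < T → InjOn (Θ T) X := fun T hT =>
    (hδinj T hT).injOn.comp hinj (mapsTo_univ _ _)
  have hΘpos : ∀ T, 0 < T → Θ T '' X ⊆ posOrthant d := by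
    rintro T hT _ ⟨a, ha, rfl⟩ i
    simpa [hΘ] using mul_pos (hl0 T hT i) (hpos a ha i)
  have hΘmeas : ∀ T, 0 < T → MeasurableSet (Θ T '' X) := fun T hT =>
    measurable_image_of_fderivWithin hX (hΘ' T) (hΘinj T hT)
  have hint : ∀ T, 0 < T → IntegrableOn
      (fun a => |(P' a).det| * (∏ i, l T i) * (χ a * K (Θ T a))) X := by
    intro T hT
    have h1 := (integrableOn_image_iff_integrableOn_abs_det_fderiv_smul volume hX (hΘ' T)
      (hΘinj T hT) K).1 (hK.mono_set (hΘpos T hT))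
    simp only [hdet T hT, smul_eq_mul] at h1
    have h2 : IntegrableOn (fun a => χ a * (|(P' a).det| * (∏ i, l T i) * K (Θ T a))) X := by
      refine Integrable.bdd_mul (c := Cχ) h1 hχm ?_
      filter_upwards [ae_restrict_mem hX] with a ha
      exact hχb a ha
    refine h2.congr (Eventually.of_forall fun a => ?_)
    simp only
    ring
  refine ⟨hint, ?_⟩
  -- This is the integrand transported to the variable `t`; off the image of `X` it is cut off by an
  -- indicator, so that the domain no longer depends on `T`.
  set Ψ : ℝ → Eu d → ℝ := fun T t => χ (Function.invFunOn (Θ T) X t) * K t with hΨ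
  have hinv : ∀ T, 0 < T → ∀ a ∈ X, Function.invFunOn (Θ T) X (Θ T a) = a := fun T hT =>
    (hΘinj T hT).leftInvOn_invFunOn
  have hint2 : ∀ T, 0 < T → IntegrableOn (Ψ T) (Θ T '' X) := by
    intro T hT
    rw [integrableOn_image_iff_integrableOn_abs_det_fderiv_smul volume hX (hΘ' T) (hΘinj T hT)]
    refine (hint T hT).congr_fun (fun a ha => ?_) hX
    simp only [hΨ, hdet T hT, hinv T hT a ha, smul_eq_mul]
  have heq : ∀ T, 0 < T → ∫ a in X, |(P' a).det| * (∏ i, l T i) * (χ a * K (Θ T a))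
      = ∫ t in posOrthant d, (Θ T '' X).indicator (Ψ T) t := by
    intro T hT
    rw [setIntegral_indicator (hΘmeas T hT), inter_eq_self_of_subset_right (hΘpos T hT),
      integral_image_eq_integral_abs_det_fderiv_smul volume hX (hΘ' T) (hΘinj T hT)]
    refine setIntegral_congr_fun hX fun a ha => ?_
    simp only [hΨ, hdet T hT, hinv T hT a ha, smul_eq_mul]
  refine Tendsto.congr' (f₁ := fun T => ∫ t in posOrthant d, (Θ T '' X).indicator (Ψ T) t) ?_ ?_
  · filter_upwards [eventually_gt_atTop 0] with T hT
    exact (heq T hT).symm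
  -- The absolute value matters when `X` is empty: the bound on `χ` then does not force `Cχ` to be
  -- nonnegative.
  refine tendsto_integral_filter_of_dominated_convergence (fun t => |Cχ| * ‖K t‖) ?_ ?_
    (hK.norm.const_mul _) ?_
  · filter_upwards [eventually_gt_atTop 0] with T hT
    exact ((integrable_indicator_iff (hΘmeas T hT)).2 (hint2 T hT)).aestronglyMeasurable.restrict
  · filter_upwards [eventually_gt_atTop 0] with T hT
    refine Eventually.of_forall fun t => ?_
    by_cases ht : t ∈ Θ T '' X
    · obtain ⟨a, ha, rfl⟩ := ht
      rw [indicator_of_mem (mem_image_of_mem _ ha), hΨ]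
      simp only [hinv T hT a ha, norm_mul]
      gcongr
      exact (hχb a ha).trans (le_abs_self _)
    · rw [indicator_of_notMem ht, norm_zero]
      positivity
  · filter_upwards [ae_restrict_mem (isOpen_posOrthant d).measurableSet] with t ht
    -- For fixed `t`, the point `l(T)⁻¹ t` tends to the vertex inside the orthant, so eventually it
    -- is `P a` with `χ a = 1`.
    have hs : Tendsto (fun T => diagonalScaling (fun i => (l T i)⁻¹) t) atTop
        (𝓝[posOrthant d] 0) := by
      refine tendsto_nhdsWithin_iff.2 ⟨?_, ?_⟩
      · rw [show (0 : Eu d) = WithLp.toLp 2 (fun _ => 0) from rfl]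
        have : ∀ T, diagonalScaling (fun i => (l T i)⁻¹) t
            = WithLp.toLp 2 (fun i => (l T i)⁻¹ * t i) := by
          intro T; ext i; simp
        simp only [this]
        refine (PiLp.continuous_toLp 2 _).continuousAt.tendsto.comp ?_
        rw [tendsto_pi_nhds]
        intro i
        simpa using (tendsto_inv_atTop_zero.comp (hl i)).mul_const (t i)
      · filter_upwards [eventually_gt_atTop 0] with T hT i
        simpa using mul_pos (inv_pos.2 (hl0 T hT i)) (ht i)
    refine tendsto_const_nhds.congr' ?_
    filter_upwards [hs.eventually hχ1, eventually_gt_atTop 0] with T ⟨a, ha, hPa, hχa⟩ hT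
    have hΘa : Θ T a = t := by
      ext i
      simp [hΘ, hPa, (hl0 T hT i).ne']
    rw [← hΘa, indicator_of_mem (mem_image_of_mem _ ha)]
    simp [hΨ, hinv T hT a ha, hχa]

/-- The localised Gaussian integral over `X × ℝᵈ`: integrability, and its limit as `T → ∞`. -/
theorem tendsto_integral_gaussian_family (hS : ∀ i, (S i).toLinearMap.IsSymmetric) {c : ℝ}
    (hc0 : 0 < c) (hc : ∀ i z, c * ‖z‖ ^ 2 ≤ inner ℝ (S i z) z) (hX : MeasurableSet X)
    (hP' : ∀ a ∈ X, HasFDerivWithinAt P (P' a) X a) (hinj : InjOn P X)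
    (hpos : ∀ a ∈ X, P a ∈ posOrthant d) (hfin : volume (P '' X) ≠ ⊤)
    {ε : ℝ} (hε : ∀ a ∈ X, (P' a).det = ε * |(P' a).det|)
    (hχm : AEStronglyMeasurable χ (volume.restrict X)) {Cχ : ℝ} (hχb : ∀ a ∈ X, |χ a| ≤ Cχ)
    (hχ1 : ∀ᶠ s in 𝓝[posOrthant d] 0, ∃ a ∈ X, P a = s ∧ χ a = 1)
    {m : ℕ} {b : Fin d → ℕ} (hb : ∀ i, m < b i) (κ : ℝ) {f : ℝ → Eu d × Eu d → ℝ}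
    (hf : ∀ T, 0 < T → ∀ a ∈ X, ∀ y, f T (a, y) = κ * χ a * (∏ i, T ^ b i) * (P' a).det *
      (Ω (fun i => S i y) *
        Real.exp (-weightedForm S (diagonalScaling (fun i => T ^ b i) (P a)) y
          - T ^ m * ‖y‖ ^ 2))) :
    (∀ T, 0 < T → IntegrableOn (f T) (X ×ˢ univ)) ∧
    Tendsto (fun T => ∫ z in X ×ˢ univ, f T z) atTop
      (𝓝 (κ * ε * ∫ t in posOrthant d, gaussianTransform S Ω t)) := by
  set g : ℝ → Eu d × Eu d → ℝ := fun T z => κ * χ z.1 * (∏ i, T ^ b i) * (ε * |(P' z.1).det|) *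
      (Ω (fun i => S i z.2) *
        Real.exp (-weightedForm S (diagonalScaling (fun i => T ^ b i) (P z.1)) z.2
          - T ^ m * ‖z.2‖ ^ 2)) with hg
  have hXu : MeasurableSet (X ×ˢ (univ : Set (Eu d))) := hX.prod MeasurableSet.univ
  have hfg : ∀ T, 0 < T → EqOn (f T) (g T) (X ×ˢ univ) := by
    rintro T hT ⟨a, y⟩ ⟨ha, -⟩
    rw [hf T hT a ha y, hg]
    simp only
    rw [← hε a ha]
  have hμ : (volume : Measure (Eu d × Eu d)).restrict (X ×ˢ univ)
      = (volume.restrict X).prod volume := by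
    rw [Measure.volume_eq_prod, ← Measure.prod_restrict, Measure.restrict_univ]
  have hPm : AEStronglyMeasurable P (volume.restrict X) :=
    ContinuousOn.aestronglyMeasurable (fun a ha => (hP' a ha).continuousWithinAt) hX
  -- By change of variables the Jacobian has integral `volume (P '' X)`, which is finite. This gives
  -- integrability on the product without bounding derivatives near the edge of `X`.
  have hdetint : IntegrableOn (fun a => |(P' a).det|) X := by
    have := (integrableOn_image_iff_integrableOn_abs_det_fderiv_smul volume hX hP' hinj
      (fun _ => (1 : ℝ))).1 (integrableOn_const hfin)
    simpa using this
  obtain ⟨C₁, hC₁, hΩb⟩ := abs_alternating_comp_le Ω S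
  have hgint : ∀ T, 0 < T → Integrable (g T) ((volume.restrict X).prod volume) := by
    intro T hT
    have hTm : 0 < T ^ m := pow_pos hT m
    have hbound : Integrable (fun z : Eu d × Eu d => (|κ| * Cχ * (∏ i, T ^ b i) * |ε| * C₁) *
        (|(P' z.1).det| * (‖z.2‖ ^ d * Real.exp (-T ^ m * ‖z.2‖ ^ 2))))
        ((volume.restrict X).prod volume) :=
      (hdetint.mul_prod (integrable_pow_norm_mul_exp_neg hTm d)).const_mul _
    refine hbound.mono' ?_ ?_
    · refine AEStronglyMeasurable.mul ?_ ?_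
      · exact (((hχm.comp_fst.const_mul κ).mul_const _)).mul
          (hdetint.aestronglyMeasurable.comp_fst.const_mul ε)
      · have hcont : Continuous (fun q : Eu d × Eu d => Ω (fun i => S i q.2) *
            Real.exp (-weightedForm S (diagonalScaling (fun i => T ^ b i) q.1) q.2
              - T ^ m * ‖q.2‖ ^ 2)) := by
          have h1 := (continuous_alternating_comp Ω S).comp (continuous_snd (X := Eu d))
          have h2 := (continuous_weightedForm S).comp
            (f := fun q : Eu d × Eu d => (diagonalScaling (fun i => T ^ b i) q.1, q.2))
            (by fun_prop)
          exact h1.mul ((h2.neg.sub ((continuous_snd.norm.pow 2).const_mul (T ^ m))).rexp)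
        have hpair : AEStronglyMeasurable (fun z : Eu d × Eu d => (P z.1, z.2))
            ((volume.restrict X).prod volume) :=
          hPm.comp_fst.prodMk measurable_snd.aestronglyMeasurable
        exact hcont.comp_aestronglyMeasurable hpair
    · rw [← hμ]
      filter_upwards [ae_restrict_mem hXu] with z hz
      have ha := hz.1
      have hw := weightedForm_nonneg (S := S) hc0 hc
        (t := diagonalScaling (fun i => T ^ b i) (P z.1)) (fun i => by
          rw [diagonalScaling_apply]
          exact mul_nonneg (pow_nonneg hT.le _) (hpos _ ha i).le) z.2
      have hprod : 0 ≤ ∏ i, T ^ b i := Finset.prod_nonneg fun i _ => pow_nonneg hT.le _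
      have hCχ : 0 ≤ Cχ := (abs_nonneg _).trans (hχb _ ha)
      simp only [hg, norm_mul, Real.norm_eq_abs, abs_abs, abs_of_nonneg hprod, Real.abs_exp]
      calc _ ≤ |κ| * Cχ * (∏ i, T ^ b i) * (|ε| * |(P' z.1).det|) *
            (C₁ * ‖z.2‖ ^ d * Real.exp (-T ^ m * ‖z.2‖ ^ 2)) := by
            gcongr
            · exact hχb _ ha
            · exact hΩb _
            · linarith
        _ = _ := by ring
  -- The scaling exponents `b i - m` are what is left of the weights after the fibre variable
  -- absorbs `T ^ m`; they are positive because `m < b i`.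
  have hl0 : ∀ T : ℝ, 0 < T → ∀ i, 0 < T ^ (b i - m) := fun T hT i => pow_pos hT _
  have hl : ∀ i, Tendsto (fun T : ℝ => T ^ (b i - m)) atTop atTop := fun i =>
    tendsto_pow_atTop (Nat.sub_ne_zero_of_lt (hb i))
  obtain ⟨-, hlim⟩ := tendsto_integral_comp_diagonalScaling hX hP' hinj hpos hχm hχb hχ1
    (integrableOn_gaussianTransform S Ω hS hc0 hc) hl0 hl
  refine ⟨fun T hT => ?_, ?_⟩
  · refine IntegrableOn.congr_fun ?_ (hfg T hT).symm hXu
    rw [IntegrableOn, hμ]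
    exact hgint T hT
  · refine (hlim.const_mul (κ * ε)).congr' ?_
    filter_upwards [eventually_gt_atTop 0] with T hT
    rw [setIntegral_congr_fun hXu (hfg T hT), hμ, integral_prod _ (hgint T hT),
      ← integral_const_mul]
    refine integral_congr_ae (Eventually.of_forall fun a => ?_)
    simp only [hg]
    rw [integral_const_mul, integral_alternating_mul_exp_eq Ω (pow_pos hT m)]
    have h1 : (T ^ m)⁻¹ • diagonalScaling (fun i => T ^ b i) (P a)
        = diagonalScaling (fun i => T ^ (b i - m)) (P a) := by
      ext i
      simp only [PiLp.smul_apply, diagonalScaling_apply, smul_eq_mul]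
      rw [pow_sub₀ _ hT.ne' (hb i).le]
      ring
    have h2 : ∏ i, T ^ (b i - m) = (∏ i, T ^ b i) * ((T ^ m) ^ d)⁻¹ := by
      have : ∀ i ∈ Finset.univ, T ^ (b i - m) = T ^ b i * (T ^ m)⁻¹ := fun i _ =>
        pow_sub₀ _ hT.ne' (hb i).le
      rw [Finset.prod_congr rfl this, Finset.prod_mul_distrib]
      simp
    rw [h1, h2]
    ring

end LaplaceLimit

/-! ### The sign of the interleaved wedge product -/

section BlockDeterminant

/-- The determinant of a block triangular matrix whose columns are interleaved; the sign of the
interleaving permutation is the constant `σ`. -/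
lemma exists_det_interleaved_eq (d : ℕ) : ∃ σ : ℝ, ∀ (M : Matrix (Fin (d * 2)) (Fin (d * 2)) ℝ)
    (A D : Matrix (Fin d) (Fin d) ℝ),
    (∀ j i, M (Fin.cast (Nat.mul_two d).symm (Fin.castAdd d j)) (finProdFinEquiv (i, 0)) = A j i) →
    (∀ j i, M (Fin.cast (Nat.mul_two d).symm (Fin.natAdd d j)) (finProdFinEquiv (i, 0)) = 0) →
    (∀ j i, M (Fin.cast (Nat.mul_two d).symm (Fin.natAdd d j)) (finProdFinEquiv (i, 1)) = D j i) →
    M.det = σ * (A.det * D.det) := by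
  -- `e₁` lists base directions before fibre directions, while `e₂` separates the even columns (the
  -- `dρ` factors) from the odd ones (the `dh` factors). Their discrepancy `τ` depends on `d` only.
  let e₁ : Fin d ⊕ Fin d ≃ Fin (d * 2) :=
    (finSumFinEquiv (m := d) (n := d)).trans (finCongr (Nat.mul_two d).symm)
  let e₂ : Fin d ⊕ Fin d ≃ Fin (d * 2) :=
    (((Equiv.boolProdEquivSum (Fin d)).symm.trans (Equiv.prodComm _ _)).trans
      (Equiv.prodCongr (Equiv.refl _) finTwoEquiv.symm)).trans finProdFinEquiv
  let τ : Equiv.Perm (Fin d ⊕ Fin d) := e₂.trans e₁.symm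
  refine ⟨(Equiv.Perm.sign τ : ℤ), fun M A D hA h0 hD => ?_⟩
  have h1 : M.submatrix e₁ e₂ = Matrix.fromBlocks A
      (Matrix.of fun j i => M (e₁ (Sum.inl j)) (e₂ (Sum.inr i))) 0 D := by
    ext (j | j) (i | i)
    · exact hA j i
    · rfl
    · exact h0 j i
    · exact hD j i
  have h2 : M.submatrix e₁ e₂ = (M.submatrix e₁ e₁).submatrix id τ := by
    ext j i
    simp [τ]
  have h3 : (M.submatrix e₁ e₂).det = (Equiv.Perm.sign τ : ℤ) * M.det := by
    rw [h2, Matrix.det_permute', Matrix.det_submatrix_equiv_self]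
  rw [h1, Matrix.det_fromBlocks_zero₂₁] at h3
  rw [h3, ← mul_assoc, ← Int.cast_mul, ← Units.val_mul, Int.units_mul_self]
  simp

end BlockDeterminant

/-! ### Smooth frames, their coordinates, and parallelism -/

section FrameCoordinates

variable {d : ℕ} {M : Type*} [TopologicalSpace M] [ChartedSpace (Eu d) M]
  {F : M → Type*} [TopologicalSpace (TotalSpace (Eu d) F)]
  [∀ x, AddCommGroup (F x)] [∀ x, Module ℝ (F x)] [∀ x, TopologicalSpace (F x)]
  [FiberBundle (Eu d) F] [VectorBundle ℝ (Eu d) F]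
  [ContMDiffVectorBundle ∞ (Eu d) F (𝓡 d)]

/-- The matrix of the frame `s` in the trivialization `t`, as a map `ℝᵈ → ℝᵈ`. -/
noncomputable def frameMap (t : Trivialization (Eu d) (TotalSpace.proj : TotalSpace (Eu d) F → M))
    (s : Fin d → (x : M) → F x) (x : M) : Eu d →L[ℝ] Eu d :=
  ∑ j, (EuclideanSpace.proj j : Eu d →L[ℝ] ℝ).smulRight (t ⟨x, s j x⟩).2

variable {t : Trivialization (Eu d) (TotalSpace.proj : TotalSpace (Eu d) F → M)}
  [MemTrivializationAtlas t]
  {s : Fin d → (x : M) → F x} {u : Set M}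

lemma frameMap_apply {x : M} (hx : x ∈ t.baseSet) (c : Eu d) :
    frameMap t s x c = (t ⟨x, ∑ j, c j • s j x⟩).2 := by
  have h : ∀ w : F x, (t ⟨x, w⟩).2 = t.linearEquivAt ℝ x hx w := fun w => rfl
  rw [h, map_sum]
  simp only [frameMap, sum_apply, ContinuousLinearMap.smulRight_apply, map_smul, h]
  rfl

lemma exists_equiv_frameMap (hs : IsLocalFrameOn (𝓡 d) (Eu d) ∞ s u) {x : M}
    (hx : x ∈ t.baseSet) (hxu : x ∈ u) :
    ∃ A : Eu d ≃L[ℝ] Eu d, (A : Eu d →L[ℝ] Eu d) = frameMap t s x := by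
  let A₀ : Eu d ≃ₗ[ℝ] Eu d := (WithLp.linearEquiv 2 ℝ (Fin d → ℝ)).trans
    ((hs.toBasisAt hxu).equivFun.symm.trans (t.linearEquivAt ℝ x hx))
  refine ⟨A₀.toContinuousLinearEquiv, ?_⟩
  ext1 c
  rw [frameMap_apply hx]
  change t.linearEquivAt ℝ x hx ((hs.toBasisAt hxu).equivFun.symm c)
    = t.linearEquivAt ℝ x hx (∑ j, c j • s j x)
  simp [Module.Basis.equivFun_symm_apply]

/-- This writes frame coefficients through the inverse of a smooth family of invertible maps, from
which their smoothness follows. -/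
lemma frameMap_inverse_apply (hs : IsLocalFrameOn (𝓡 d) (Eu d) ∞ s u) {v : TotalSpace (Eu d) F}
    (hx : v.proj ∈ t.baseSet) (hxu : v.proj ∈ u) (j : Fin d) :
    (frameMap t s v.proj).inverse (t v).2 j = hs.coeff j v.proj v.2 := by
  obtain ⟨A, hA⟩ := exists_equiv_frameMap hs hx hxu
  have h2 : (t v).2 = A (WithLp.toLp 2 (fun j => hs.coeff j v.proj v.2)) := by
    have := frameMap_apply (s := s) hx (WithLp.toLp 2 (fun j => hs.coeff j v.proj v.2))
    rw [← hA] at this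
    refine Eq.trans ?_ this.symm
    have h3 : v.2 = ∑ j, hs.coeff j v.proj v.2 • s j v.proj := by
      have := (hs.toBasisAt hxu).sum_repr v.2
      conv_lhs => rw [← this]
      simp [IsLocalFrameOn.coeff, hxu]
    conv_lhs => rw [show v = ⟨v.proj, v.2⟩ from rfl, h3]
  rw [← hA, ContinuousLinearMap.inverse_equiv, h2]
  simp

lemma contMDiffAt_frameMap (hs : IsLocalFrameOn (𝓡 d) (Eu d) ∞ s u) (hu : IsOpen u) {x : M}
    (hx : x ∈ t.baseSet) (hxu : x ∈ u) :
    ContMDiffAt (𝓡 d) 𝓘(ℝ, Eu d →L[ℝ] Eu d) ∞ (frameMap t s) x := by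
  have h1 : ∀ j, ContMDiffAt (𝓡 d) 𝓘(ℝ, Eu d) ∞ (fun x => (t ⟨x, s j x⟩).2) x := fun j =>
    (t.contMDiffAt_section_iff hx).1 (hs.contMDiffAt hu hxu j)
  change ContMDiffAt (𝓡 d) 𝓘(ℝ, Eu d →L[ℝ] Eu d) ∞
    (fun x => ∑ j, (EuclideanSpace.proj j : Eu d →L[ℝ] ℝ).smulRight (t ⟨x, s j x⟩).2) x
  refine contMDiffAt_finsetSum fun j _ => ?_
  have h2 : ContDiff ℝ ∞ (fun w : Eu d => (EuclideanSpace.proj j : Eu d →L[ℝ] ℝ).smulRight w) :=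
    (ContinuousLinearMap.smulRightL ℝ (Eu d) (Eu d) (EuclideanSpace.proj j)).contDiff
  exact h2.contDiffAt.comp_contMDiffAt (h1 j)

/-- The linear fibre coordinates of a smooth frame are smooth functions on the total space. -/
lemma contMDiffAt_frame_coeff (hs : IsLocalFrameOn (𝓡 d) (Eu d) ∞ s u) (hu : IsOpen u)
    {v : TotalSpace (Eu d) F} (hv : v.proj ∈ u) (j : Fin d) :
    ContMDiffAt ((𝓡 d).prod 𝓘(ℝ, Eu d)) 𝓘(ℝ, ℝ) ∞
      (fun w : TotalSpace (Eu d) F => hs.coeff j w.proj w.2) v := by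
  set t := trivializationAt (Eu d) F v.proj with ht
  have hx : v.proj ∈ t.baseSet := mem_baseSet_trivializationAt (Eu d) F v.proj
  have hproj := (contMDiff_proj (n := ∞) (IB := 𝓡 d) F).contMDiffAt (x := v)
  have hsnd : ContMDiffAt ((𝓡 d).prod 𝓘(ℝ, Eu d)) 𝓘(ℝ, Eu d) ∞
      (fun w : TotalSpace (Eu d) F => (t w).2) v :=
    (contMDiffAt_totalSpace.1 contMDiffAt_id).2
  obtain ⟨A, hA⟩ := exists_equiv_frameMap hs hx hv
  have hinv : ContMDiffAt (𝓡 d) 𝓘(ℝ, Eu d →L[ℝ] Eu d) ∞ (fun x => (frameMap t s x).inverse)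
      v.proj := by
    have h1 := contDiffAt_map_inverse (𝕜 := ℝ) (n := ∞) A
    rw [hA] at h1
    exact h1.comp_contMDiffAt (contMDiffAt_frameMap hs hu hx hv)
  have h2 : ContMDiffAt ((𝓡 d).prod 𝓘(ℝ, Eu d)) 𝓘(ℝ, Eu d) ∞
      (fun w : TotalSpace (Eu d) F => (frameMap t s w.proj).inverse (t w).2) v :=
    (hinv.comp v hproj).clm_apply hsnd
  have h3 : ContMDiffAt ((𝓡 d).prod 𝓘(ℝ, Eu d)) 𝓘(ℝ, ℝ) ∞
      (fun w : TotalSpace (Eu d) F => (frameMap t s w.proj).inverse (t w).2 j) v :=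
    ((EuclideanSpace.proj j : Eu d →L[ℝ] ℝ).contDiff.contDiffAt (n := ∞)).comp_contMDiffAt h2
  refine h3.congr_of_eventuallyEq ?_
  have hev : ∀ᶠ w : TotalSpace (Eu d) F in 𝓝 v, w.proj ∈ u ∩ t.baseSet :=
    hproj.continuousAt ((hu.inter t.open_baseSet).mem_nhds ⟨hv, hx⟩)
  filter_upwards [hev] with w hw
  exact (frameMap_inverse_apply hs hw.2 hw.1 j).symm

lemma contMDiffAt_frame_coeff_section (hs : IsLocalFrameOn (𝓡 d) (Eu d) ∞ s u) (hu : IsOpen u)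
    {x : M} (hx : x ∈ u) {τ : (x : M) → F x}
    (hτ : ContMDiffAt (𝓡 d) ((𝓡 d).prod 𝓘(ℝ, Eu d)) ∞ (fun x => TotalSpace.mk' (Eu d) x (τ x)) x)
    (j : Fin d) :
    ContMDiffAt (𝓡 d) 𝓘(ℝ, ℝ) ∞ (fun x => hs.coeff j x (τ x)) x :=
  (contMDiffAt_frame_coeff hs hu (v := TotalSpace.mk' (Eu d) x (τ x)) hx j).comp x hτ

/-- Linear combinations of a smooth frame, as a map to the total space, depend smoothly on the
base point and the coefficients. -/
lemma contMDiffAt_frame_param (hs : IsLocalFrameOn (𝓡 d) (Eu d) ∞ s u) (hu : IsOpen u)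
    {f : Eu d → M} {z : Eu d × Eu d} (hf : ContMDiffAt (𝓡 d) (𝓡 d) ∞ f z.1) (hz : f z.1 ∈ u) :
    ContMDiffAt 𝓘(ℝ, Eu d × Eu d) ((𝓡 d).prod 𝓘(ℝ, Eu d)) ∞
      (fun z : Eu d × Eu d => (⟨f z.1, ∑ j, z.2 j • s j (f z.1)⟩ : TotalSpace (Eu d) F)) z := by
  have hfst : ContMDiffAt 𝓘(ℝ, Eu d × Eu d) (𝓡 d) ∞ (fun z : Eu d × Eu d => f z.1) z := by
    refine ContMDiffAt.comp z hf ?_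
    exact contDiff_fst.contMDiff.contMDiffAt
  rw [contMDiffAt_totalSpace]
  refine ⟨hfst, ?_⟩
  set t := trivializationAt (Eu d) F (f z.1) with ht
  have hx : f z.1 ∈ t.baseSet := mem_baseSet_trivializationAt (Eu d) F _
  have h1 : ContMDiffAt 𝓘(ℝ, Eu d × Eu d) 𝓘(ℝ, Eu d) ∞
      (fun z : Eu d × Eu d => frameMap t s (f z.1) z.2) z := by
    refine ContMDiffAt.clm_apply (g := fun z : Eu d × Eu d => frameMap t s (f z.1))
      (ContMDiffAt.comp z (g := frameMap t s) (contMDiffAt_frameMap hs hu hx hz) hfst) ?_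
    exact contDiff_snd.contMDiff.contMDiffAt
  refine h1.congr_of_eventuallyEq ?_
  have hev : ∀ᶠ z' : Eu d × Eu d in 𝓝 z, f z'.1 ∈ t.baseSet :=
    hfst.continuousAt (t.open_baseSet.mem_nhds hx)
  filter_upwards [hev] with z' hz'
  exact (frameMap_apply hz' _).symm

variable [∀ x, IsTopologicalAddGroup (F x)] [∀ x, ContinuousSMul ℝ (F x)]
  (cov : CovariantDerivative (𝓡 d) (Eu d) F)

/-- Additivity and the Leibniz rule, by induction on the index set. -/
lemma CovariantDerivative.sum_smul_apply {ι : Type*} (I : Finset ι) {g : ι → M → ℝ}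
    {σ : ι → (x : M) → F x} {x : M}
    (hσ : ∀ i, MDifferentiableAt (𝓡 d) ((𝓡 d).prod 𝓘(ℝ, Eu d))
      (fun x => TotalSpace.mk' (Eu d) x (σ i x)) x)
    (hg : ∀ i, MDifferentiableAt (𝓡 d) 𝓘(ℝ, ℝ) (g i) x) :
    cov (fun x => ∑ i ∈ I, g i x • σ i x) x
      = ∑ i ∈ I, (g i x • cov (σ i) x + (mvfderiv (𝓡 d) (g i) x).smulRight (σ i x)) := by
  classical
  have hcov := cov.isCovariantDerivativeOnUniv
  induction I using Finset.induction_on with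
  | empty =>
    simp only [Finset.sum_empty]
    exact hcov.zero
  | insert i I hi ih =>
    have h1 : MDifferentiableAt (𝓡 d) ((𝓡 d).prod 𝓘(ℝ, Eu d))
        (fun x => TotalSpace.mk' (Eu d) x ((g i • σ i) x)) x := (hg i).smul_section (hσ i)
    have h2 : MDifferentiableAt (𝓡 d) ((𝓡 d).prod 𝓘(ℝ, Eu d))
        (fun x => TotalSpace.mk' (Eu d) x (∑ k ∈ I, g k x • σ k x)) x :=
      MDifferentiableAt.sum_section fun k _ => (hg k).smul_section (hσ k)
    have h3 : (fun x => ∑ k ∈ insert i I, g k x • σ k x)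
        = g i • σ i + fun x => ∑ k ∈ I, g k x • σ k x := by
      ext x
      simp [Finset.sum_insert hi]
    rw [h3, hcov.add h1 h2, ih, hcov.leibniz (hσ i) (hg i), Finset.sum_insert hi]

/-- The transition functions between two parallel frames have zero differential. -/
lemma CovariantDerivative.mvfderiv_coeff_eq_zero {s : Fin d → (x : M) → F x} {u : Set M}
    (hs : IsLocalFrameOn (𝓡 d) (Eu d) ∞ s u) (hu : IsOpen u) {x : M} (hx : x ∈ u)
    (hpar : ∀ j, cov (s j) x = 0) {τ : (x : M) → F x}
    (hτ : ContMDiffAt (𝓡 d) ((𝓡 d).prod 𝓘(ℝ, Eu d)) ∞ (fun x => TotalSpace.mk' (Eu d) x (τ x)) x)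
    (hτpar : cov τ x = 0) (j : Fin d) :
    mvfderiv (𝓡 d) (fun x => hs.coeff j x (τ x)) x = 0 := by
  have hcov := cov.isCovariantDerivativeOnUniv
  have hσ : ∀ i, MDifferentiableAt (𝓡 d) ((𝓡 d).prod 𝓘(ℝ, Eu d))
      (fun x => TotalSpace.mk' (Eu d) x (s i x)) x := fun i =>
    (hs.contMDiffAt hu hx i).mdifferentiableAt (by simp)
  have hg : ∀ i, MDifferentiableAt (𝓡 d) 𝓘(ℝ, ℝ) (fun x => hs.coeff i x (τ x)) x := fun i =>
    (contMDiffAt_frame_coeff_section hs hu hx hτ i).mdifferentiableAt (by simp)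
  -- Expanding `τ` in the parallel frame leaves only the terms `dc_i ⊗ s_i`; linear independence of
  -- the frame then kills every `dc_i`.
  have h1 : cov τ x = cov (fun x => ∑ i, hs.coeff i x (τ x) • s i x) x := by
    refine hcov.congr_of_eventuallyEq (hτ.mdifferentiableAt (by simp))
      (MDifferentiableAt.sum_section fun k _ => (hg k).smul_section (hσ k)) univ_mem ?_
    exact hs.eventually_eq_sum_coeff_smul τ (hu.mem_nhds hx)
  rw [hτpar, cov.sum_smul_apply Finset.univ hσ hg] at h1
  ext w
  have h2 := congrArg (fun L => L w) h1
  simp only [hpar, smul_zero, zero_add] at h2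
  have h3 : ∑ i, mvfderiv (𝓡 d) (fun x => hs.coeff i x (τ x)) x w • s i x = 0 := by
    refine Eq.trans ?_ h2.symm
    simp
  have h4 := Fintype.linearIndependent_iff.1 (hs.linearIndependent hx) _ h3 j
  simpa using h4

end FrameCoordinates

/-! ### The coefficient of the form in oriented coordinates -/

section CoordinateExpression

variable {d : ℕ}

variable (d) in
/-- The determinant of `d` vectors of Euclidean space, in the standard basis. -/
noncomputable def euclideanDet : Eu d [⋀^Fin d]→L[ℝ] ℝ where
  toMultilinearMap := ((Matrix.detRowAlternating : (Fin d → ℝ) [⋀^Fin d]→ₗ[ℝ] ℝ).compLinearMap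
    (WithLp.linearEquiv 2 ℝ (Fin d → ℝ)).toLinearMap).toMultilinearMap
  map_eq_zero_of_eq' := ((Matrix.detRowAlternating : (Fin d → ℝ) [⋀^Fin d]→ₗ[ℝ] ℝ).compLinearMap
    (WithLp.linearEquiv 2 ℝ (Fin d → ℝ)).toLinearMap).map_eq_zero_of_eq'
  cont := by
    change Continuous fun v : Fin d → Eu d => Matrix.det (Matrix.of fun i j => v i j)
    refine Continuous.matrix_det (continuous_matrix fun i j => ?_)
    simp only [Matrix.of_apply]
    fun_prop

lemma euclideanDet_apply (v : Fin d → Eu d) :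
    euclideanDet d v = Matrix.det (Matrix.of fun i j => v i j) := rfl

lemma det_euclidean_eq (L : Eu d →L[ℝ] Eu d) :
    L.det = Matrix.det (Matrix.of fun j i => L (EuclideanSpace.single j 1) i) := by
  rw [ContinuousLinearMap.det,
    ← LinearMap.det_toMatrix (EuclideanSpace.basisFun (Fin d) ℝ).toBasis, ← Matrix.det_transpose]
  congr 1

lemma prodBasisVec_castAdd (j : Fin d) :
    prodBasisVec d (Fin.cast (Nat.mul_two d).symm (Fin.castAdd d j))
      = (EuclideanSpace.single j 1, 0) :=
  Fin.append_left (fun i : Fin d => ((EuclideanSpace.single i (1 : ℝ), 0) : Eu d × Eu d))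
    (fun j : Fin d => ((0, EuclideanSpace.single j (1 : ℝ)) : Eu d × Eu d)) j

lemma prodBasisVec_natAdd (j : Fin d) :
    prodBasisVec d (Fin.cast (Nat.mul_two d).symm (Fin.natAdd d j))
      = (0, EuclideanSpace.single j 1) :=
  Fin.append_right (fun i : Fin d => ((EuclideanSpace.single i (1 : ℝ), 0) : Eu d × Eu d))
    (fun j : Fin d => ((0, EuclideanSpace.single j (1 : ℝ)) : Eu d × Eu d)) j

/-- Only fibre derivatives of the squared coordinates enter the determinant, since the `dρ` columns
vanish on fibre directions. Along a fibre the coordinate is linear. -/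
lemma fderiv_sq_apply_snd {f : Eu d × Eu d → ℝ} {a y : Eu d} (hf : DifferentiableAt ℝ f (a, y))
    (L : Eu d →L[ℝ] ℝ) (hL : ∀ y, f (a, y) = L y) (v : Eu d) :
    fderiv ℝ (fun z => f z ^ 2) (a, y) (0, v) = 2 * (L y * L v) := by
  have h1 : HasFDerivAt (fun w => f (a, w) ^ 2)
      ((fderiv ℝ (fun z => f z ^ 2) (a, y)).comp (ContinuousLinearMap.inr ℝ (Eu d) (Eu d))) y :=
    HasFDerivAt.comp (g := fun z => f z ^ 2) y (hf.pow 2).hasFDerivAt (hasFDerivAt_prodMk_right a y)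
  have h2 : HasFDerivAt (fun w => f (a, w) ^ 2) ((2 * L y) • L) y := by
    simp only [hL]
    simpa using L.hasFDerivAt.pow 2
  have h3 := congrArg (fun A => A v) (h1.unique h2)
  simpa [mul_assoc] using h3

variable {M : Type*} [TopologicalSpace M] [ChartedSpace (Eu d) M]
  {F : M → Type*} [TopologicalSpace (TotalSpace (Eu d) F)]
  [∀ x, AddCommGroup (F x)] [∀ x, Module ℝ (F x)] [∀ x, TopologicalSpace (F x)]
  [FiberBundle (Eu d) F] [VectorBundle ℝ (Eu d) F]
  [ContMDiffVectorBundle ∞ (Eu d) F (𝓡 d)]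
  {oM : ManifoldOrientation d M} {oF : BundleOrientation d F}

lemma OrientedBundleChart.mdifferentiableAt_param (B : OrientedBundleChart oM oF)
    {a : Eu d} (ha : a ∈ B.chart.target) (y : Eu d) :
    MDifferentiableAt 𝓘(ℝ, Eu d × Eu d) ((𝓡 d).prod 𝓘(ℝ, Eu d)) B.param (a, y) := by
  have h : ContMDiffAt (𝓡 d) (𝓡 d) ∞ B.chart.symm a :=
    (contMDiffOn_symm_of_mem_maximalAtlas B.chart_mem).contMDiffAt
      (B.chart.open_target.mem_nhds ha)
  exact (contMDiffAt_frame_param (z := (a, y)) B.isLocalFrameOn B.chart.open_source h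
    (B.chart.map_target ha)).mdifferentiableAt (by simp)

lemma OrientedBundleChart.mvfderiv_mfderiv_param (B : OrientedBundleChart oM oF)
    {a : Eu d} (ha : a ∈ B.chart.target) (y : Eu d) {f : TotalSpace (Eu d) F → ℝ}
    (hf : MDifferentiableAt ((𝓡 d).prod 𝓘(ℝ, Eu d)) 𝓘(ℝ, ℝ) f (B.param (a, y)))
    (w : Eu d × Eu d) :
    mvfderiv ((𝓡 d).prod 𝓘(ℝ, Eu d)) f (B.param (a, y))
      (mfderiv 𝓘(ℝ, Eu d × Eu d) ((𝓡 d).prod 𝓘(ℝ, Eu d)) B.param (a, y) w)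
      = fderiv ℝ (fun z => f (B.param z)) (a, y) w := by
  have h := mvfderiv_comp_apply (a, y) hf (B.mdifferentiableAt_param ha y) w
  rw [← h]
  simp only [mvfderiv, mfderiv_eq_fderiv]
  rfl

variable [∀ x, IsTopologicalAddGroup (F x)] [∀ x, ContinuousSMul ℝ (F x)]
  [IsManifold (𝓡 d) ∞ M]
  {g : ContMDiffRiemannianMetric (𝓡 d) ∞ (Eu d) (fun x : M => TangentSpace (𝓡 d) x)}
  {cov : CovariantDerivative (𝓡 d) (Eu d) F} {N : ℕ}

lemma TransversalCovering.mdifferentiableAt_y (C : TransversalCovering g cov N) (α : Fin N)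
    (j : Fin d) {v : TotalSpace (Eu d) F} (hv : v.proj ∈ C.U α) :
    MDifferentiableAt ((𝓡 d).prod 𝓘(ℝ, Eu d)) 𝓘(ℝ, ℝ) (C.y α j) v :=
  (contMDiffAt_frame_coeff (C.isLocalFrameOn α) (C.chart α).open_source hv j).mdifferentiableAt
    (by simp)

lemma TransversalCovering.mdifferentiableAt_ρ_proj (C : TransversalCovering g cov N) (α : Fin N)
    (v : TotalSpace (Eu d) F) :
    MDifferentiableAt ((𝓡 d).prod 𝓘(ℝ, Eu d)) 𝓘(ℝ, ℝ)
      (fun w : TotalSpace (Eu d) F => C.ρ α w.proj) v := by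
  have h1 : ContMDiffAt ((𝓡 d).prod 𝓘(ℝ, Eu d)) 𝓘(ℝ, ℝ) ∞
      (fun w : TotalSpace (Eu d) F => C.ρ α w.proj) v :=
    ((C.ρ_smooth α).comp (contMDiff_proj (n := ∞) (IB := 𝓡 d) F)).contMDiffAt
  exact h1.mdifferentiableAt (by simp)

/-- The form in oriented coordinates in which the transition functions are constant. -/
lemma exists_coeff_localForm_eq (d : ℕ) : ∃ κ : ℝ, ∀ {M : Type*} [TopologicalSpace M]
    [ChartedSpace (Eu d) M]
    {F : M → Type*} [TopologicalSpace (TotalSpace (Eu d) F)]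
    [∀ x, AddCommGroup (F x)] [∀ x, Module ℝ (F x)] [∀ x, TopologicalSpace (F x)]
    [FiberBundle (Eu d) F] [VectorBundle ℝ (Eu d) F]
    [ContMDiffVectorBundle ∞ (Eu d) F (𝓡 d)]
    [∀ x, IsTopologicalAddGroup (F x)] [∀ x, ContinuousSMul ℝ (F x)]
    [IsManifold (𝓡 d) ∞ M]
    {oM : ManifoldOrientation d M} {oF : BundleOrientation d F}
    {g : ContMDiffRiemannianMetric (𝓡 d) ∞ (Eu d) (fun x : M => TangentSpace (𝓡 d) x)}
    {cov : CovariantDerivative (𝓡 d) (Eu d) F} {N : ℕ}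
    (B : OrientedBundleChart oM oF) (C : TransversalCovering g cov N)
    (α₁ : Fin N) (β : Fin d → Fin N) (φ : M → ℝ) (T : ℝ) (a : Eu d)
    (_ : a ∈ B.chart.target) (_ : ∀ i, B.chart.symm a ∈ C.U (β i))
    (G : Fin d → Eu d →L[ℝ] Eu d) (_ : ∀ i y j, C.y (β i) j (B.param (a, y)) = G i y j)
    (_ : ∀ y, ∑ j, C.y α₁ j (B.param (a, y)) ^ 2 = ‖y‖ ^ 2)
    (P : Eu d → Eu d) (_ : ∀ b i, P b i = C.ρ (β i) (B.chart.symm b))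
    (P' : Eu d →L[ℝ] Eu d) (_ : HasFDerivAt P P' a) (y : Eu d),
    B.coeff (C.localForm α₁ β φ T) (a, y)
      = κ * φ (B.chart.symm a) * (∏ i, T ^ ((β i : ℕ) + 1)) * P'.det *
        (euclideanDet d (fun i => ((G i).adjoint ∘L G i) y) *
          Real.exp (-weightedForm (fun i => (G i).adjoint ∘L G i)
            (diagonalScaling (fun i => T ^ ((β i : ℕ) + 1)) (P a)) y
            - T ^ ((α₁ : ℕ) + 1) * ‖y‖ ^ 2)) := by
  obtain ⟨σ, hσ⟩ := exists_det_interleaved_eq d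
  -- The interleaving sign, the normalisation of the `dρ` factors, and a factor 2 from each
  -- differential of squares. All depend on `d` alone, so the constant is fixed before the geometric
  -- data.
  refine ⟨σ * ((4 * Real.pi)⁻¹) ^ d * 2 ^ d, ?_⟩
  intro M _ _ F _ _ _ _ _ _ _ _ _ _ oM oF g cov N B C α₁ β φ T a ha hU G hG hα P hP P' hP' y
  set v := B.param (a, y) with hv
  have hvproj : v.proj = B.chart.symm a := rfl
  set A : Matrix (Fin d) (Fin d) ℝ := Matrix.of fun j i =>
    (T ^ ((β i : ℕ) + 1) * (4 * Real.pi)⁻¹) * P' (EuclideanSpace.single j 1) i with hA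
  set D : Matrix (Fin d) (Fin d) ℝ := Matrix.of fun j i =>
    2 * ((G i).adjoint ∘L G i) y j with hD
  have hρ : ∀ i (w : Eu d × Eu d), C.dρ (β i) v
      (mfderiv 𝓘(ℝ, Eu d × Eu d) ((𝓡 d).prod 𝓘(ℝ, Eu d)) B.param (a, y) w) = P' w.1 i := by
    intro i w
    refine (B.mvfderiv_mfderiv_param ha y (C.mdifferentiableAt_ρ_proj (β i) v) w).trans ?_
    have h1 : (fun z : Eu d × Eu d => C.ρ (β i) (B.param z).proj) = fun z => P z.1 i := by
      ext z
      exact (hP z.1 i).symm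
    rw [h1]
    have h2 : HasFDerivAt (fun z : Eu d × Eu d => P z.1 i)
        (((EuclideanSpace.proj i : Eu d →L[ℝ] ℝ).comp P').comp
          (ContinuousLinearMap.fst ℝ (Eu d) (Eu d))) (a, y) := by
      have h3 : HasFDerivAt (fun b : Eu d => P b i)
          ((EuclideanSpace.proj i : Eu d →L[ℝ] ℝ).comp P') a :=
        (EuclideanSpace.proj i : Eu d →L[ℝ] ℝ).hasFDerivAt.comp a hP'
      exact HasFDerivAt.comp (g := fun b : Eu d => P b i) (a, y) h3 hasFDerivAt_fst
    rw [h2.fderiv]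
    rfl
  have hh : ∀ i (w : Eu d), C.dh (β i) v
      (mfderiv 𝓘(ℝ, Eu d × Eu d) ((𝓡 d).prod 𝓘(ℝ, Eu d)) B.param (a, y) (0, w))
      = 2 * inner ℝ (((G i).adjoint ∘L G i) y) w := by
    intro i w
    have hdy := fun j => C.mdifferentiableAt_y (β i) j (v := v) (hU i)
    have h1 : ∀ j, mvfderiv ((𝓡 d).prod 𝓘(ℝ, Eu d))
        (fun w : TotalSpace (Eu d) F => C.y (β i) j w ^ 2) v
        (mfderiv 𝓘(ℝ, Eu d × Eu d) ((𝓡 d).prod 𝓘(ℝ, Eu d)) B.param (a, y) (0, w))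
        = 2 * (G i y j * G i w j) := by
      intro j
      have hd : DifferentiableAt ℝ (fun z => C.y (β i) j (B.param z)) (a, y) :=
        (MDifferentiableAt.comp (g := C.y (β i) j) (a, y) (hdy j) (B.mdifferentiableAt_param ha y)).differentiableAt
      have hsq : MDifferentiableAt ((𝓡 d).prod 𝓘(ℝ, Eu d)) 𝓘(ℝ, ℝ)
          (fun w : TotalSpace (Eu d) F => C.y (β i) j w ^ 2) v := by
        simp only [pow_two]
        exact (hdy j).mul (hdy j)
      refine (B.mvfderiv_mfderiv_param ha y hsq (0, w)).trans ?_
      exact fderiv_sq_apply_snd hd ((EuclideanSpace.proj j : Eu d →L[ℝ] ℝ).comp (G i))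
        (fun y => hG i y j) w
    have h2 : C.dh (β i) v
      (mfderiv 𝓘(ℝ, Eu d × Eu d) ((𝓡 d).prod 𝓘(ℝ, Eu d)) B.param (a, y) (0, w))
      = ∑ j, 2 * (G i y j * G i w j) := by
      rw [← Finset.sum_congr rfl fun j _ => h1 j]
      simp only [TransversalCovering.dh, LinearMap.sum_apply]
      rfl
    rw [h2, ← Finset.mul_sum, ContinuousLinearMap.comp_apply,
      ContinuousLinearMap.adjoint_inner_left, PiLp.inner_apply]
    congr 1
    refine Finset.sum_congr rfl fun j _ => ?_
    simp [mul_comm]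
  have hwedge : wedgeForms (fun k : Fin (d * 2) =>
      if k.modNat = 0 then (C.pow T (β k.divNat) / (4 * Real.pi)) • C.dρ (β k.divNat) v
      else C.dh (β k.divNat) v) (fun k => mfderiv 𝓘(ℝ, Eu d × Eu d) ((𝓡 d).prod 𝓘(ℝ, Eu d))
        B.param (a, y) (prodBasisVec d k)) = σ * (A.det * D.det) := by
    have hdm : ∀ (i : Fin d) (r : Fin 2), (finProdFinEquiv (i, r)).divNat = i ∧
        (finProdFinEquiv (i, r)).modNat = r := by
      intro i r
      have := finProdFinEquiv.symm_apply_apply (i, r)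
      rw [finProdFinEquiv_symm_apply, Prod.mk.injEq] at this
      exact this
    refine hσ (Matrix.of fun j k => (if k.modNat = 0 then
      (C.pow T (β k.divNat) / (4 * Real.pi)) • C.dρ (β k.divNat) v
      else C.dh (β k.divNat) v) (mfderiv 𝓘(ℝ, Eu d × Eu d) ((𝓡 d).prod 𝓘(ℝ, Eu d))
        B.param (a, y) (prodBasisVec d j))) A D ?_ ?_ ?_
    · intro j i
      rw [Matrix.of_apply, (hdm i 0).1, (hdm i 0).2, if_pos rfl, LinearMap.smul_apply, hρ,
        prodBasisVec_castAdd]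
      rfl
    · intro j i
      rw [Matrix.of_apply, (hdm i 0).1, (hdm i 0).2, if_pos rfl, LinearMap.smul_apply, hρ,
        prodBasisVec_natAdd]
      simp
    · intro j i
      rw [Matrix.of_apply, (hdm i 1).1, (hdm i 1).2, if_neg (by simp), prodBasisVec_natAdd, hh]
      simp [hD, EuclideanSpace.inner_single_right]
  have hAdet : A.det = (∏ i, T ^ ((β i : ℕ) + 1)) * ((4 * Real.pi)⁻¹) ^ d * P'.det := by
    rw [det_euclidean_eq]
    have := Matrix.det_mul_row (fun i => T ^ ((β i : ℕ) + 1) * (4 * Real.pi)⁻¹)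
      (Matrix.of fun j i => P' (EuclideanSpace.single j 1) i)
    rw [Finset.prod_mul_distrib] at this
    simpa [hA] using this
  have hDdet : D.det = 2 ^ d * euclideanDet d (fun i => ((G i).adjoint ∘L G i) y) := by
    rw [euclideanDet_apply, ← Matrix.det_transpose]
    have := Matrix.det_smul (Matrix.of fun i j => ((G i).adjoint ∘L G i) y j) (2 : ℝ)
    rw [Fintype.card_fin] at this
    rw [← this]
    rfl
  have hexp : -(∑ i, ∑ j, C.ρ (β i) v.proj * C.pow T (β i) * C.y (β i) j v ^ 2)
      - C.pow T α₁ * ∑ j, C.y α₁ j v ^ 2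
      = -weightedForm (fun i => (G i).adjoint ∘L G i)
            (diagonalScaling (fun i => T ^ ((β i : ℕ) + 1)) (P a)) y
            - T ^ ((α₁ : ℕ) + 1) * ‖y‖ ^ 2 := by
    rw [hα y]
    congr 2
    refine Finset.sum_congr rfl fun i _ => ?_
    rw [← Finset.mul_sum, diagonalScaling_apply, hP, ContinuousLinearMap.comp_apply,
      ContinuousLinearMap.adjoint_inner_left, real_inner_self_eq_norm_sq,
      EuclideanSpace.real_norm_sq_eq]
    simp only [hv, hG i y]
    rw [mul_comm (T ^ _)]
    rfl
  change (φ v.proj * Real.exp _) • wedgeForms _ _ = _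
  rw [hwedge, hAdet, hDdet, hexp, hvproj, smul_eq_mul]
  ring

end CoordinateExpression

/-! ### Monotonicity and inversion of the flat profile -/

section FlatProfile

lemma flatProfile_of_pos {t : ℝ} (ht : 0 < t) : flatProfile t = Real.exp (-1 / t ^ 2) :=
  if_neg ht.ne'

lemma flatProfile_zero : flatProfile 0 = 0 := if_pos rfl

lemma flatProfile_pos {t : ℝ} (ht : 0 < t) : 0 < flatProfile t := by
  rw [flatProfile_of_pos ht]
  exact Real.exp_pos _

lemma flatProfile_le_one {t : ℝ} (ht : 0 < t) : flatProfile t ≤ 1 := by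
  rw [flatProfile_of_pos ht, Real.exp_le_one_iff]
  exact div_nonpos_of_nonpos_of_nonneg (by norm_num) (sq_nonneg t)

lemma strictMonoOn_flatProfile : StrictMonoOn flatProfile (Ioi 0) := by
  intro s hs t ht hst
  have hs' : (0 : ℝ) < s := hs
  rw [flatProfile_of_pos hs, flatProfile_of_pos ht, Real.exp_lt_exp, neg_div, neg_div,
    neg_lt_neg_iff]
  exact one_div_lt_one_div_of_lt (by positivity) (by gcongr)

/-- Solving `exp (-1 / t ^ 2) = s` gives `t = (-log s)^(-1/2)`, which is defined because `s < 1`. -/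
lemma exists_flatProfile_eq {s : ℝ} (hs : 0 < s) (hs1 : s < 1) : ∃ t, 0 < t ∧ flatProfile t = s := by
  have hlog : 0 < -Real.log s := neg_pos.2 (Real.log_neg hs hs1)
  have hpos : 0 < (√(-Real.log s))⁻¹ := inv_pos.2 (Real.sqrt_pos.2 hlog)
  refine ⟨_, hpos, ?_⟩
  rw [flatProfile_of_pos hpos, inv_pow, Real.sq_sqrt hlog.le, div_inv_eq_mul, neg_one_mul, neg_neg,
    Real.exp_log hs]

lemma exists_hasDerivAt_flatProfile {t : ℝ} (ht : 0 < t) :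
    ∃ c, 0 < c ∧ HasDerivAt flatProfile c t := by
  refine ⟨Real.exp (-1 / t ^ 2) * (2 / t ^ 3), by positivity, ?_⟩
  have h1 : HasDerivAt (fun t : ℝ => -1 / t ^ 2) (2 / t ^ 3) t := by
    have := ((hasDerivAt_const t (-1 : ℝ)).fun_div (hasDerivAt_pow 2 t) (by positivity))
    convert! this using 1
    field_simp
    norm_num
  refine h1.exp.congr_of_eventuallyEq ?_
  filter_upwards [lt_mem_nhds ht] with s hs
  exact flatProfile_of_pos hs

end FlatProfile

/-! ### Transversal functions and the model of a corner -/

section LocalGeometry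

variable {d : ℕ} {M : Type*} [TopologicalSpace M] [ChartedSpace (Eu d) M] [IsManifold (𝓡 d) ∞ M]

lemma surjective_mfderiv_symm_of_mem_maximalAtlas {e : OpenPartialHomeomorph M (Eu d)}
    (he : e ∈ IsManifold.maximalAtlas (𝓡 d) ∞ M) {p : M} (hp : p ∈ e.source) :
    Function.Surjective (mfderiv (𝓡 d) (𝓡 d) e.symm (e p)) := by
  have hd : e.MDifferentiable (𝓡 d) (𝓡 d) :=
    ⟨(contMDiffOn_of_mem_maximalAtlas he).mdifferentiableOn (by simp),
      (contMDiffOn_symm_of_mem_maximalAtlas he).mdifferentiableOn (by simp)⟩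
  intro v
  refine ⟨mfderiv (𝓡 d) (𝓡 d) e p (show TangentSpace (𝓡 d) p from v), ?_⟩
  exact congrArg (fun L => L (show TangentSpace (𝓡 d) p from v)) (hd.symm_comp_deriv hp)

/-- Functions with linearly independent differentials have invertible Jacobian in a chart. -/
lemma det_fderiv_comp_symm_ne_zero {e : OpenPartialHomeomorph M (Eu d)}
    (he : e ∈ IsManifold.maximalAtlas (𝓡 d) ∞ M) {p : M} (hp : p ∈ e.source) {r : Fin d → M → ℝ}
    (hr : ∀ i, MDifferentiableAt (𝓡 d) 𝓘(ℝ, ℝ) (r i) p)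
    (hli : LinearIndependent ℝ (fun i => mvfderiv (𝓡 d) (r i) p))
    {R' : Eu d →L[ℝ] Eu d}
    (hR : HasFDerivAt (fun b => (WithLp.toLp 2 fun i => r i (e.symm b) : Eu d)) R' (e p)) :
    R'.det ≠ 0 := by
  have hsymm : e.symm (e p) = p := e.left_inv hp
  have hsd : MDifferentiableAt (𝓡 d) (𝓡 d) e.symm (e p) :=
    ((contMDiffOn_symm_of_mem_maximalAtlas he).contMDiffAt
      (e.open_target.mem_nhds (e.map_source hp))).mdifferentiableAt (by simp)
  have hcomp : ∀ i w, R' w i = mvfderiv (𝓡 d) (r i) p (mfderiv (𝓡 d) (𝓡 d) e.symm (e p) w) := by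
    intro i w
    have h1 := mvfderiv_comp_apply_of_eq (e p) (hr i) hsd hsymm w
    rw [← h1]
    have h2 : HasFDerivAt (fun b => r i (e.symm b))
        ((EuclideanSpace.proj i : Eu d →L[ℝ] ℝ).comp R') (e p) :=
      (EuclideanSpace.proj i : Eu d →L[ℝ] ℝ).hasFDerivAt.comp (e p) hR
    have h3 : mvfderiv (𝓡 d) (r i ∘ e.symm) (e p) w = fderiv ℝ (r i ∘ e.symm) (e p) w := by
      simp only [mvfderiv, mfderiv_eq_fderiv]
      rfl
    rw [h3]
    exact (congrArg (fun L => L w) h2.fderiv).symm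
  -- A linear relation among the columns of the Jacobian is a relation among the differentials,
  -- because the derivative of the inverse chart is onto the tangent space.
  have hunit : IsUnit (Matrix.of fun j i => R' (EuclideanSpace.single j 1) i) := by
    rw [← Matrix.linearIndependent_cols_iff_isUnit, Fintype.linearIndependent_iff]
    intro c hc
    refine Fintype.linearIndependent_iff.1 hli c ?_
    ext v
    obtain ⟨w, rfl⟩ := surjective_mfderiv_symm_of_mem_maximalAtlas he hp v
    have h4 : ∀ j, ∑ i, c i * R' (EuclideanSpace.single j 1) i = 0 := by
      intro j
      have := congrFun hc j
      simpa using this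
    have h5 : ∀ w : Eu d, ∑ i, c i * R' w i = 0 := by
      intro w
      have h6 : w = ∑ j, w j • (EuclideanSpace.single j (1 : ℝ) : Eu d) := by
        ext a
        simp [Pi.single_apply]
      rw [h6]
      simp only [map_sum, map_smul, WithLp.ofLp_sum, WithLp.ofLp_smul, Finset.sum_apply,
        Pi.smul_apply, smul_eq_mul, Finset.mul_sum]
      rw [Finset.sum_comm]
      refine Finset.sum_eq_zero fun j _ => ?_
      calc _ = w j * ∑ i, c i * R' (EuclideanSpace.single j 1) i := by
            rw [Finset.mul_sum]
            exact Finset.sum_congr rfl fun i _ => by ring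
        _ = 0 := by rw [h4, mul_zero]
    have h7 : ∑ i, c i * mvfderiv (𝓡 d) (r i) p (mfderiv (𝓡 d) (𝓡 d) e.symm (e p) w) = 0 := by
      exact (Finset.sum_congr rfl fun i _ => congrArg (c i * ·) (hcomp i w).symm).trans (h5 w)
    have h8 : ∀ v : TangentSpace (𝓡 d) p, (∑ i, c i • mvfderiv (𝓡 d) (r i) p) v
        = ∑ i, c i * mvfderiv (𝓡 d) (r i) p v := by
      intro v
      simp
    exact (h8 _).trans h7
  rw [det_euclidean_eq]
  exact ((Matrix.isUnit_iff_isUnit_det _).1 hunit).ne_zero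

/-- `X` with the map `P` is a model of a corner: `P` maps the open connected set `X`
diffeomorphically, with constant orientation, onto a bounded subset of the open positive orthant
which contains all its points near the vertex, and the points of `X` with small image are close
to `c`. -/
structure IsCornerChart (P : Eu d → Eu d) (X : Set (Eu d)) (c : Eu d) : Prop where
  isOpen : IsOpen X
  isPreconnected : IsPreconnected X
  nonempty : X.Nonempty
  injOn : InjOn P X
  mem_posOrthant : ∀ a ∈ X, P a ∈ posOrthant d
  volume_image_ne_top : volume (P '' X) ≠ ⊤
  exists_sign : ∃ ε : ℝ, ∀ a ∈ X, (fderiv ℝ P a).det = ε * |(fderiv ℝ P a).det|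
  differentiableAt : ∀ a ∈ X, DifferentiableAt ℝ P a
  eventually_exists : ∀ Z ∈ 𝓝 c, ∀ᶠ s in 𝓝[posOrthant d] 0, ∃ a ∈ X, P a = s ∧ a ∈ Z

variable (d) in
lemma convex_posOrthant : Convex ℝ (posOrthant d) := by
  intro x hx y hy s t hs ht hst i
  have h1 := hx i
  have h2 := hy i
  simp only [PiLp.add_apply, PiLp.smul_apply, smul_eq_mul]
  rcases hs.eq_or_lt with rfl | hs'
  · rw [zero_add] at hst
    subst hst
    simpa using h2
  · have := mul_pos hs' h1
    have := mul_nonneg ht h2.le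
    linarith

lemma exists_flatProfile_coord_eq {η : ℝ} (hη : 0 < η) :
    ∀ᶠ s : Eu d in 𝓝[posOrthant d] 0, ∃ x ∈ posOrthant d, ‖x‖ < η ∧
      ∀ i, flatProfile (x i) = s i := by
  -- Coordinates below `η / (d + 1)` have sum below `η`, and the sum dominates the norm.
  have hη' : 0 < η / (d + 1) := by positivity
  have h1 : ∀ i : Fin d, ∀ᶠ s : Eu d in 𝓝[posOrthant d] 0,
      s i < min 1 (flatProfile (η / (d + 1))) := by
    intro i
    refine Filter.Eventually.filter_mono nhdsWithin_le_nhds ?_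
    have hc : Continuous fun s : Eu d => s i := by fun_prop
    exact hc.continuousAt.eventually_lt continuousAt_const
      (lt_min (by simp) (by simpa using flatProfile_pos hη'))
  filter_upwards [eventually_all.2 h1, self_mem_nhdsWithin] with s hs hpos
  choose x hx0 hx using fun i => exists_flatProfile_eq (hpos i) ((lt_min_iff.1 (hs i)).1)
  refine ⟨WithLp.toLp 2 x, hx0, ?_, hx⟩
  have hlt : ∀ i, x i < η / (d + 1) := by
    intro i
    refine (strictMonoOn_flatProfile.lt_iff_lt (hx0 i) hη').1 ?_
    rw [hx i]
    exact (lt_min_iff.1 (hs i)).2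
  calc ‖(WithLp.toLp 2 x : Eu d)‖ ≤ ∑ i, x i := norm_le_sum_coord fun i => (hx0 i).le
    _ ≤ ∑ _i : Fin d, η / (d + 1) := Finset.sum_le_sum fun i _ => (hlt i).le
    _ < η := by
      rw [Finset.sum_const, Finset.card_univ, Fintype.card_fin, nsmul_eq_mul, mul_div_assoc',
        div_lt_iff₀ (by positivity)]
      nlinarith

/-- Composing a local diffeomorphism with the flat profile in each coordinate. -/
lemma isCornerChart_of_flatProfile (f : OpenPartialHomeomorph (Eu d) (Eu d)) {c : Eu d}
    (hc : c ∈ f.source) (hfc : f c = 0) (hfd : ∀ b ∈ f.source, DifferentiableAt ℝ f b) {D₀ : ℝ}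
    (hsign : ∀ b ∈ f.source, 0 < (fderiv ℝ f b).det * D₀) {δ : ℝ} (hδ : 0 < δ)
    (hball : Metric.ball 0 δ ⊆ f.target) {P : Eu d → Eu d}
    (hP : ∀ b ∈ f.source, f b ∈ posOrthant d → ∀ i, P b i = flatProfile (f b i)) :
    IsCornerChart P (f.source ∩ f ⁻¹' (Metric.ball 0 δ ∩ posOrthant d)) c := by
  set X := f.source ∩ f ⁻¹' (Metric.ball 0 δ ∩ posOrthant d) with hX
  have hBopen : IsOpen (Metric.ball (0 : Eu d) δ ∩ posOrthant d) :=
    Metric.isOpen_ball.inter (isOpen_posOrthant d)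
  have hXopen : IsOpen X := f.isOpen_inter_preimage hBopen
  have hXimg : X = f.symm '' (Metric.ball 0 δ ∩ posOrthant d) := by
    rw [f.symm_image_eq_source_inter_preimage (inter_subset_left.trans hball)]
  -- Convexity in the flattened coordinates is the source of the connectedness of `X`.
  have hconv : Convex ℝ (Metric.ball (0 : Eu d) δ ∩ posOrthant d) :=
    (convex_ball 0 δ).inter (convex_posOrthant d)
  have hPX : ∀ a ∈ X, ∀ i, P a i = flatProfile (f a i) := fun a ha => hP a ha.1 ha.2.2
  have hpos : ∀ a ∈ X, P a ∈ posOrthant d := by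
    intro a ha i
    rw [hPX a ha]
    exact flatProfile_pos (ha.2.2 i)
  have hder : ∀ a ∈ X, ∃ l : Fin d → ℝ, (∀ i, 0 < l i) ∧
      HasFDerivAt P ((diagonalScaling l).comp (fderiv ℝ f a)) a := by
    intro a ha
    choose l hl0 hl using fun i => exists_hasDerivAt_flatProfile (ha.2.2 i)
    refine ⟨l, hl0, ?_⟩
    have h1 : HasFDerivAt (fun b => WithLp.toLp 2 fun i => flatProfile (f b i) : Eu d → Eu d)
        ((diagonalScaling l).comp (fderiv ℝ f a)) a := by
      rw [← hasFDerivWithinAt_univ, hasFDerivWithinAt_euclidean]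
      intro i
      have h2 : HasFDerivAt (fun b => f b i)
          ((EuclideanSpace.proj i : Eu d →L[ℝ] ℝ).comp (fderiv ℝ f a)) a :=
        (EuclideanSpace.proj i : Eu d →L[ℝ] ℝ).hasFDerivAt.comp a (hfd a ha.1).hasFDerivAt
      refine (((hl i).comp_hasFDerivAt a h2).congr_fderiv ?_).hasFDerivWithinAt
      ext v
      simp
    refine h1.congr_of_eventuallyEq ?_
    filter_upwards [hXopen.mem_nhds ha] with b hb
    ext i
    exact hPX b hb i
  refine ⟨hXopen, ?_, ?_, ?_, hpos, ?_, ?_, ?_, ?_⟩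
  · rw [hXimg]
    exact hconv.isPreconnected.image _ (f.continuousOn_symm.mono (inter_subset_left.trans hball))
  · rw [hXimg, image_nonempty]
    refine ⟨WithLp.toLp 2 fun _ => δ / (2 * (d + 1)), ?_, fun i => ?_⟩
    · rw [mem_ball_zero_iff]
      calc _ ≤ ∑ _i : Fin d, δ / (2 * (d + 1)) :=
            norm_le_sum_coord (t := WithLp.toLp 2 fun _ => δ / (2 * (d + 1)))
              fun i => by simp only; positivity
        _ < δ := by
          rw [Finset.sum_const, Finset.card_univ, Fintype.card_fin, nsmul_eq_mul, mul_div_assoc',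
            div_lt_iff₀ (by positivity)]
          have : (0 : ℝ) ≤ d := Nat.cast_nonneg d
          nlinarith
    · simp only
      positivity
  · intro a ha b hb hab
    refine f.injOn ha.1 hb.1 ?_
    ext i
    refine strictMonoOn_flatProfile.injOn (ha.2.2 i) (hb.2.2 i) ?_
    rw [← hPX a ha, ← hPX b hb, hab]
  · refine ((measure_mono ?_).trans_lt
      (measure_closedBall_lt_top (x := (0 : Eu d)) (r := (d : ℝ)))).ne
    rintro _ ⟨a, ha, rfl⟩
    rw [mem_closedBall_zero_iff]
    refine (norm_le_sum_coord fun i => (hpos a ha i).le).trans ?_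
    calc ∑ i, P a i ≤ ∑ _i : Fin d, (1 : ℝ) := Finset.sum_le_sum fun i _ => by
          rw [hPX a ha]
          exact flatProfile_le_one (ha.2.2 i)
      _ = d := by simp
  -- The profile has positive derivative in each coordinate, so the Jacobian of `P` has the same
  -- sign as that of `f`.
  · refine ⟨SignType.sign D₀, fun a ha => ?_⟩
    obtain ⟨l, hl0, hl⟩ := hder a ha
    have h1 : (fderiv ℝ P a).det = (∏ i, l i) * (fderiv ℝ f a).det := by
      rw [hl.fderiv, ← det_diagonalScaling]
      exact LinearMap.det_comp _ _
    have h2 : 0 < ∏ i, l i := Finset.prod_pos fun i _ => hl0 i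
    have h3 := hsign a ha.1
    rcases lt_trichotomy D₀ 0 with hD | hD | hD
    · have h4 : (fderiv ℝ f a).det < 0 := by
        by_contra! h
        nlinarith
      rw [h1, sign_neg hD, abs_of_neg (mul_neg_of_pos_of_neg h2 h4)]
      simp
    · simp [hD] at h3
    · have h4 : 0 < (fderiv ℝ f a).det := by
        by_contra! h
        nlinarith
      rw [h1, sign_pos hD, abs_of_pos (mul_pos h2 h4)]
      simp
  · intro a ha
    obtain ⟨l, -, hl⟩ := hder a ha
    exact hl.differentiableAt
  · intro Z hZ
    have h0t : (0 : Eu d) ∈ f.target := hball (Metric.mem_ball_self hδ)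
    have hf0 : f.symm 0 = c := by rw [← hfc, f.left_inv hc]
    have hnear : f.symm ⁻¹' Z ∩ Metric.ball 0 δ ∈ 𝓝 (0 : Eu d) := by
      refine inter_mem ?_ (Metric.ball_mem_nhds _ hδ)
      exact (f.continuousAt_symm h0t) (by rwa [hf0])
    obtain ⟨η, hη, hηs⟩ := Metric.mem_nhds_iff.1 hnear
    filter_upwards [exists_flatProfile_coord_eq hη] with s ⟨x, hx, hxη, hxs⟩
    have hxm := hηs (mem_ball_zero_iff.2 hxη)
    have hxt := hball hxm.2
    have hXm : f.symm x ∈ X := ⟨f.map_target hxt, by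
      rw [mem_preimage, f.right_inv hxt]
      exact ⟨hxm.2, hx⟩⟩
    refine ⟨f.symm x, hXm, ?_, hxm.1⟩
    ext i
    rw [hPX _ hXm, f.right_inv hxt, hxs]

end LocalGeometry

/-! ### The corner at a vertex of the covering -/

section CornerNeighbourhood

variable {d : ℕ} {M : Type*} [TopologicalSpace M] [ChartedSpace (Eu d) M] [IsManifold (𝓡 d) ∞ M]
  {F : M → Type*} [TopologicalSpace (TotalSpace (Eu d) F)]
  [∀ x, AddCommGroup (F x)] [∀ x, Module ℝ (F x)] [∀ x, TopologicalSpace (F x)]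
  [FiberBundle (Eu d) F]
  [∀ x, IsTopologicalAddGroup (F x)] [∀ x, ContinuousSMul ℝ (F x)]
  {g : ContMDiffRiemannianMetric (𝓡 d) ∞ (Eu d) (fun x : M => TangentSpace (𝓡 d) x)}
  {cov : CovariantDerivative (𝓡 d) (Eu d) F} {N : ℕ}

/-- A smooth map which at `c` vanishes and has invertible derivative is, near `c`, an open partial
homeomorphism whose Jacobian determinant has constant sign. -/
lemma exists_openPartialHomeomorph_det_sign {R : Eu d → Eu d} {Y : Set (Eu d)} (hY : IsOpen Y)
    {c : Eu d} (hc : c ∈ Y) (hR : ContDiffOn ℝ ∞ R Y) (hdet : (fderiv ℝ R c).det ≠ 0) :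
    ∃ f : OpenPartialHomeomorph (Eu d) (Eu d), ⇑f = R ∧ c ∈ f.source ∧ f.source ⊆ Y ∧
      ∀ b ∈ f.source, 0 < (fderiv ℝ R b).det * (fderiv ℝ R c).det := by
  have hRc : ContDiffAt ℝ ∞ R c := hR.contDiffAt (hY.mem_nhds hc)
  have hstrict : HasStrictFDerivAt R
      ((ContinuousLinearMap.toContinuousLinearEquivOfDetNeZero _ hdet : Eu d ≃L[ℝ] Eu d) :
        Eu d →L[ℝ] Eu d) c := by
    simpa using hRc.hasStrictFDerivAt (by simp)
  have hcont : ContinuousOn (fun b => (fderiv ℝ R b).det * (fderiv ℝ R c).det) Y :=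
    (ContinuousLinearMap.continuous_det.comp_continuousOn
      (hR.continuousOn_fderiv_of_isOpen hY (by simp))).mul continuousOn_const
  have hopen : IsOpen (Y ∩ (fun b => (fderiv ℝ R b).det * (fderiv ℝ R c).det) ⁻¹' Ioi 0) :=
    hcont.isOpen_inter_preimage hY isOpen_Ioi
  -- The domain given by the inverse function theorem is shrunk to where the determinant keeps its
  -- sign at `c`.
  refine ⟨(hstrict.toOpenPartialHomeomorph R).restrOpen _ hopen, ?_, ?_, ?_, ?_⟩
  · simp
  · simp only [OpenPartialHomeomorph.restrOpen_source]
    exact ⟨hstrict.mem_toOpenPartialHomeomorph_source, hc, mul_self_pos.2 hdet⟩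
  · simp only [OpenPartialHomeomorph.restrOpen_source]
    exact inter_subset_right.trans inter_subset_left
  · intro b hb
    simp only [OpenPartialHomeomorph.restrOpen_source] at hb
    exact hb.2.2

/-- On the boundary the profile takes its value at 0; outside the closure the support condition
applies. -/
lemma TransversalCovering.ρ_eq_zero (C : TransversalCovering g cov N) {α : Fin N} {x : M}
    (hx : x ∉ C.U α) : C.ρ α x = 0 := by
  by_cases hc : x ∈ closure (C.U α)
  · have hf : x ∈ frontier (C.U α) := by
      rw [IsOpen.frontier_eq (s := C.U α) (C.chart α).open_source]
      exact ⟨hc, hx⟩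
    obtain ⟨O, -, hO, hρ⟩ := C.ρ_near α
    obtain ⟨O', -, hO', -, -, hr, -⟩ := C.isNormal α
    rw [hρ x ⟨hO hf, hc⟩, (hr x (hO' hf)).1 hf, flatProfile_zero]
  · by_contra h
    exact hc (C.ρ_support α (subset_tsupport _ h))

lemma TransversalCovering.ρ_nonneg (C : TransversalCovering g cov N) (α : Fin N) (x : M) :
    0 ≤ C.ρ α x := by
  by_cases hx : x ∈ C.U α
  · exact (C.ρ_pos α x hx).le
  · rw [C.ρ_eq_zero hx]

/-- By transversality the `d` normal coordinates `r_{β i}` form local coordinates at `p`, in which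
the intersection of the `U (β i)` is the positive orthant. There `ρ_{β i}` is the flat profile of
`r_{β i}`, so the model corner applies. -/
lemma TransversalCovering.exists_isCornerChart (C : TransversalCovering g cov N) {p : M}
    {β : Fin d → Fin N} (hβ : Function.Injective β)
    (hβp : range β = {α | p ∈ frontier (C.U α)}) {e : OpenPartialHomeomorph M (Eu d)}
    (he : e ∈ IsManifold.maximalAtlas (𝓡 d) ∞ M) (hp : p ∈ e.source) {O : Set M} (hO : IsOpen O)
    (hpO : p ∈ O) :
    ∃ V : Set M, IsOpen V ∧ p ∈ V ∧ V ⊆ O ∩ e.source ∧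
      IsCornerChart (fun b => WithLp.toLp 2 fun i => C.ρ (β i) (e.symm b))
        (e '' (V ∩ {x | ∀ i, x ∈ C.U (β i)})) (e p) := by
  have hfr : ∀ i, p ∈ frontier (C.U (β i)) := by
    intro i
    have : β i ∈ {α | p ∈ frontier (C.U α)} := hβp ▸ mem_range_self i
    exact this
  choose O₁ hO₁ hfO₁ hr₁ hU₁ hz₁ _ using fun i => C.isNormal (β i)
  choose O₂ hO₂ hfO₂ hρ₂ using fun i => C.ρ_near (β i)
  set R : Eu d → Eu d := fun b => WithLp.toLp 2 fun i => C.r (β i) (e.symm b) with hR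
  set Q : Set M := O ∩ ⋂ i, O₁ i ∩ O₂ i with hQ
  have hQo : IsOpen Q := hO.inter (isOpen_iInter_of_finite fun i => (hO₁ i).inter (hO₂ i))
  have hpQ : p ∈ Q := ⟨hpO, mem_iInter.2 fun i => ⟨hfO₁ i (hfr i), hfO₂ i (hfr i)⟩⟩
  have hQ₁ : ∀ x ∈ Q, ∀ i, x ∈ O₁ i := fun x hx i => (mem_iInter.1 hx.2 i).1
  have hQ₂ : ∀ x ∈ Q, ∀ i, x ∈ O₂ i := fun x hx i => (mem_iInter.1 hx.2 i).2
  set Y : Set (Eu d) := e.target ∩ e.symm ⁻¹' Q with hY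
  have hYo : IsOpen Y := e.isOpen_inter_preimage_symm hQo
  have hsymm : e.symm (e p) = p := e.left_inv hp
  have hpY : e p ∈ Y := ⟨e.map_source hp, by rwa [mem_preimage, hsymm]⟩
  have hRsm : ContDiffOn ℝ ∞ R Y := by
    rw [contDiffOn_euclidean]
    intro i
    have h1 : ContMDiffOn (𝓡 d) 𝓘(ℝ, ℝ) ∞ (C.r (β i) ∘ e.symm) Y :=
      (hr₁ i).comp ((contMDiffOn_symm_of_mem_maximalAtlas he).mono inter_subset_left)
        (fun b hb => hQ₁ _ hb.2 i)
    exact h1.contDiffOn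
  have hRd : ∀ b ∈ Y, DifferentiableAt ℝ R b := fun b hb =>
    ((hRsm.contDiffAt (hYo.mem_nhds hb)).differentiableAt (by simp))
  have hli : LinearIndependent ℝ (fun i => mvfderiv (𝓡 d) (C.r (β i)) p) := by
    let ι : Fin d → {α : Fin N // p ∈ frontier (C.chart α).source} := fun i => ⟨β i, hfr i⟩
    have hι : Function.Injective ι := fun i j hij => hβ (congrArg Subtype.val hij)
    exact (C.transversal p).comp ι hι
  have hdet : (fderiv ℝ R (e p)).det ≠ 0 := by
    refine det_fderiv_comp_symm_ne_zero he hp (r := fun i => C.r (β i)) (fun i => ?_) hli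
      (hRd _ hpY).hasFDerivAt
    exact ((hr₁ i).contMDiffAt ((hO₁ i).mem_nhds (hQ₁ p hpQ i))).mdifferentiableAt (by simp)
  obtain ⟨f, hfR, hfp, hfY, hfs⟩ := exists_openPartialHomeomorph_det_sign hYo hpY hRsm hdet
  have hRp : f (e p) = 0 := by
    rw [hfR]
    ext i
    change C.r (β i) (e.symm (e p)) = 0
    rw [hsymm]
    exact (hz₁ i p (hQ₁ p hpQ i)).1 (hfr i)
  obtain ⟨δ, hδ, hball⟩ := Metric.mem_nhds_iff.1
    (f.open_target.mem_nhds (hRp ▸ f.map_source hfp))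
  have hUR : ∀ x ∈ e.source, e x ∈ f.source → ((∀ i, x ∈ C.U (β i)) ↔ f (e x) ∈ posOrthant d) := by
    intro x hx hfx
    refine forall_congr' fun i => ?_
    have hxQ : x ∈ Q := by simpa [e.left_inv hx] using (hfY hfx).2
    rw [hfR]
    change _ ↔ 0 < C.r (β i) (e.symm (e x))
    rw [e.left_inv hx]
    exact hU₁ i x (hQ₁ x hxQ i)
  set V : Set M := e.source ∩ e ⁻¹' (f.source ∩ f ⁻¹' Metric.ball 0 δ) with hV
  have hVo : IsOpen V :=
    e.isOpen_inter_preimage (f.isOpen_inter_preimage Metric.isOpen_ball)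
  have himg : e '' (V ∩ {x | ∀ i, x ∈ C.U (β i)})
      = f.source ∩ f ⁻¹' (Metric.ball 0 δ ∩ posOrthant d) := by
    ext b
    constructor
    · rintro ⟨x, ⟨⟨hxe, hxf, hxb⟩, hxU⟩, rfl⟩
      exact ⟨hxf, hxb, (hUR x hxe hxf).1 hxU⟩
    · rintro ⟨hbf, hbb, hbp⟩
      have hbt : b ∈ e.target := (hfY hbf).1
      have hb : e (e.symm b) = b := e.right_inv hbt
      refine ⟨e.symm b, ⟨⟨e.map_target hbt, ?_⟩, ?_⟩, hb⟩
      · rw [mem_preimage, hb]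
        exact ⟨hbf, hbb⟩
      · refine (hUR _ (e.map_target hbt) ?_).2 ?_
        · rwa [hb]
        · rwa [hb]
  refine ⟨V, hVo, ⟨hp, hfp, ?_⟩, ?_, ?_⟩
  · rw [mem_preimage, hRp]
    exact Metric.mem_ball_self hδ
  · rintro x ⟨hxe, hxf, -⟩
    have hxQ : x ∈ Q := by simpa [e.left_inv hxe] using (hfY hxf).2
    exact ⟨hxQ.1, hxe⟩
  · rw [himg]
    refine isCornerChart_of_flatProfile f hfp hRp (fun b hb => hfR ▸ hRd b (hfY hb))
      (fun b hb => hfR ▸ hfs b hb) hδ hball ?_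
    intro b hb hbp i
    have hbQ := (hfY hb).2
    have hbt := (hfY hb).1
    have hxU : e.symm b ∈ C.U (β i) := by
      have h1 : e (e.symm b) = b := e.right_inv hbt
      exact (hUR _ (e.map_target hbt) (by rwa [h1])).2 (by rwa [h1]) i
    rw [hfR]
    exact hρ₂ i _ ⟨hQ₂ _ hbQ i, subset_closure hxU⟩

end CornerNeighbourhood

/-! ### Oriented frames and transition maps -/

section ParallelFrames

variable {d : ℕ} {M : Type*} [TopologicalSpace M] [ChartedSpace (Eu d) M]
  {F : M → Type*} [TopologicalSpace (TotalSpace (Eu d) F)]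
  [∀ x, AddCommGroup (F x)] [∀ x, Module ℝ (F x)] [∀ x, TopologicalSpace (F x)]
  [FiberBundle (Eu d) F] [VectorBundle ℝ (Eu d) F]

lemma IsLocalFrameOn.units_smul {s : Fin d → (x : M) → F x} {u : Set M}
    (hs : IsLocalFrameOn (𝓡 d) (Eu d) ∞ s u) (w : Fin d → ℝˣ) :
    IsLocalFrameOn (𝓡 d) (Eu d) ∞ (fun i x => (w i : ℝ) • s i x) u where
  linearIndependent {x} hx := (hs.linearIndependent hx).units_smul w
  generating {x} hx := by
    have h := ((hs.toBasisAt hx).unitsSMul w).span_eq.ge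
    convert! h using 3
    ext i
    simp [Module.Basis.unitsSMul_apply, Units.smul_def]
  contMDiffOn i := ContMDiffOn.const_smul_section (hs.contMDiffOn i)

lemma IsLocalFrameOn.continuousAt_det [ContMDiffVectorBundle ∞ (Eu d) F (𝓡 d)]
    {s : Fin d → (x : M) → F x} {u : Set M}
    (hs : IsLocalFrameOn (𝓡 d) (Eu d) ∞ s u) (hu : IsOpen u) {x : M} (hx : x ∈ u)
    {σ : Fin d → (x : M) → F x} {u' : Set M} (hσ : IsLocalFrameOn (𝓡 d) (Eu d) ∞ σ u')
    (hu' : IsOpen u') (hx' : x ∈ u') :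
    ContinuousAt (fun x => Matrix.det (Matrix.of fun i j => hs.coeff i x (σ j x))) x := by
  have h : ContinuousAt (fun x => Matrix.of fun i j => hs.coeff i x (σ j x)) x := by
    refine continuousAt_pi.2 fun i => continuousAt_pi.2 fun j => ?_
    exact (contMDiffAt_frame_coeff_section hs hu hx (hσ.contMDiffAt hu' hx' j) i).continuousAt
  exact (continuous_id.matrix_det.continuousAt).comp h

/-- After a change of sign, a smooth frame is positively oriented near a given point. -/
lemma BundleOrientation.exists_units_smul_positive [ContMDiffVectorBundle ∞ (Eu d) F (𝓡 d)]
    (hd : 0 < d) (oF : BundleOrientation d F)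
    {s : Fin d → (x : M) → F x} {u : Set M} (hs : IsLocalFrameOn (𝓡 d) (Eu d) ∞ s u)
    (hu : IsOpen u) {p : M} (hp : p ∈ u) :
    ∃ (w : Fin d → ℝˣ) (u' : Set M), (∀ i, (w i : ℝ) ^ 2 = 1) ∧ IsOpen u' ∧ p ∈ u' ∧ u' ⊆ u ∧
      ∀ x ∈ u', IsPositiveBasis (oF.at' x) (fun i => (w i : ℝ) • s i x) := by
  obtain ⟨u₂, σ, hu₂, hpu₂, hσ, hσpos⟩ := oF.exists_frame p
  set D : M → ℝ := fun x => Matrix.det (Matrix.of fun i j => hs.coeff i x (σ j x)) with hD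
  have hDdet : ∀ x (hx : x ∈ u), D x = (hs.toBasisAt hx).det (fun i => σ i x) := by
    intro x hx
    have h : (Matrix.of fun i j => hs.coeff i x (σ j x))
        = (hs.toBasisAt hx).toMatrix fun i => σ i x := by
      ext i j
      simp [Module.Basis.toMatrix_apply, IsLocalFrameOn.coeff, hx]
    rw [Module.Basis.det_apply, ← h]
  have hDp : D p ≠ 0 := by
    rw [hDdet p hp]
    have h := (hs.toBasisAt hp).isUnit_det (hσ.toBasisAt hpu₂)
    have h2 : (fun i => σ i p) = ⇑(hσ.toBasisAt hpu₂) := by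
      ext i
      simp
    rw [h2]
    exact h.ne_zero
  have hDc : ContinuousAt D p := hs.continuousAt_det hu hp hσ hu₂ hpu₂
  have hev : ∀ᶠ x in 𝓝 p, x ∈ u ∩ u₂ ∧ 0 < D x * D p := by
    have h1 : ∀ᶠ x in 𝓝 p, x ∈ u ∩ u₂ := (hu.inter hu₂).mem_nhds ⟨hp, hpu₂⟩
    refine h1.and ?_
    exact (hDc.mul continuousAt_const).eventually (lt_mem_nhds (mul_self_pos.2 hDp))
  obtain ⟨u', hu'sub, hu'o, hpu'⟩ := eventually_nhds_iff.1 hev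
  have hor : ∀ x (hx : x ∈ u), x ∈ u₂ →
      ((hs.toBasisAt hx).orientation = oF.at' x ↔ 0 < D x) := by
    intro x hx hx₂
    obtain ⟨b, hb, hbo⟩ := hσpos x hx₂
    rw [← hbo, Module.Basis.orientation_eq_iff_det_pos, hDdet x hx, hb]
  rcases hDp.lt_or_gt with hneg | hpos
  -- Reversing one frame vector reverses the orientation; positive rank is needed to have such a
  -- vector.
  · refine ⟨Function.update 1 ⟨0, hd⟩ (-1), u', ?_, hu'o, hpu', fun x hx => (hu'sub x hx).1.1, ?_⟩
    · intro i
      by_cases hi : i = ⟨0, hd⟩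
      · subst hi; simp
      · simp [hi]
    · intro x hx
      obtain ⟨⟨hxu, hxu₂⟩, hDx⟩ := hu'sub x hx
      refine ⟨(hs.toBasisAt hxu).unitsSMul (Function.update 1 ⟨0, hd⟩ (-1)), ?_, ?_⟩
      · ext i
        simp [Module.Basis.unitsSMul_apply, Units.smul_def]
      · rw [Module.Basis.orientation_neg_single]
        refine ((Module.Basis.orientation_ne_iff_eq_neg _ _).1 fun h => ?_).symm
        have := (hor x hxu hxu₂).1 h.symm
        nlinarith
  · refine ⟨1, u', by simp, hu'o, hpu', fun x hx => (hu'sub x hx).1.1, ?_⟩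
    intro x hx
    obtain ⟨⟨hxu, hxu₂⟩, hDx⟩ := hu'sub x hx
    refine ⟨hs.toBasisAt hxu, ?_, (hor x hxu hxu₂).2 ?_⟩
    · ext i
      simp
    · by_contra! h
      nlinarith

/-- The frame-to-frame transition map in the fibre over `x`. -/
noncomputable def frameTransition {s : Fin d → (x : M) → F x} {u : Set M}
    (hs : IsLocalFrameOn (𝓡 d) (Eu d) ∞ s u) (σ : Fin d → (x : M) → F x) (x : M) :
    Eu d →L[ℝ] Eu d :=
  ∑ k, (EuclideanSpace.proj k : Eu d →L[ℝ] ℝ).smulRight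
    (WithLp.toLp 2 fun j => hs.coeff j x (σ k x))

lemma frameTransition_apply {s : Fin d → (x : M) → F x} {u : Set M}
    (hs : IsLocalFrameOn (𝓡 d) (Eu d) ∞ s u) (σ : Fin d → (x : M) → F x) (x : M) (y : Eu d)
    (j : Fin d) :
    frameTransition hs σ x y j = hs.coeff j x (∑ k, y k • σ k x) := by
  simp [frameTransition]

lemma injective_frameTransition {s σ : Fin d → (x : M) → F x} {u u' : Set M}
    (hs : IsLocalFrameOn (𝓡 d) (Eu d) ∞ s u) (hσ : IsLocalFrameOn (𝓡 d) (Eu d) ∞ σ u')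
    {x : M} (hx : x ∈ u) (hx' : x ∈ u') : Function.Injective (frameTransition hs σ x) := by
  rw [injective_iff_map_eq_zero]
  intro y hy
  have h1 : ∀ j, hs.coeff j x (∑ k, y k • σ k x) = 0 := by
    intro j
    rw [← frameTransition_apply, hy]
    rfl
  have h2 : ∑ k, y k • σ k x = 0 := by
    refine (hs.toBasisAt hx).repr.injective ?_
    ext j
    simpa [IsLocalFrameOn.coeff, hx] using h1 j
  ext k
  exact Fintype.linearIndependent_iff.1 (hσ.linearIndependent hx') _ h2 k

/-- A finite family of injective endomorphisms is uniformly bounded below. -/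
lemma exists_lower_bound_adjoint_comp {G : Fin d → Eu d →L[ℝ] Eu d}
    (hG : ∀ i, Function.Injective (G i)) :
    ∃ c : ℝ, 0 < c ∧ ∀ i z, c * ‖z‖ ^ 2 ≤ inner ℝ (((G i).adjoint ∘L G i) z) z := by
  have h : ∀ i, ∃ K : ℝ, ∀ z, ‖z‖ ≤ K * ‖G i z‖ := by
    intro i
    obtain ⟨K, -, hK⟩ := (G i).toLinearMap.exists_antilipschitzWith
      (LinearMap.ker_eq_bot.2 (hG i))
    exact ⟨K, fun z => hK.le_mul_norm (map_zero _) z⟩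
  choose K hK using h
  -- The summand 1 ensures positivity, since the constants `K i` carry no sign information.
  have hpos : 0 < 1 + ∑ i, K i ^ 2 := by positivity
  refine ⟨(1 + ∑ i, K i ^ 2)⁻¹, inv_pos.2 hpos, fun i z => ?_⟩
  rw [ContinuousLinearMap.comp_apply, ContinuousLinearMap.adjoint_inner_left,
    real_inner_self_eq_norm_sq, inv_mul_le_iff₀ hpos]
  have h1 : ‖z‖ ^ 2 ≤ K i ^ 2 * ‖G i z‖ ^ 2 := by
    rw [← mul_pow]
    exact pow_le_pow_left₀ (norm_nonneg z) (hK i z) 2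
  have h2 : K i ^ 2 ≤ ∑ i, K i ^ 2 :=
    Finset.single_le_sum (f := fun i => K i ^ 2) (fun i _ => sq_nonneg _) (Finset.mem_univ i)
  nlinarith [sq_nonneg ‖G i z‖]

lemma isSymmetric_adjoint_comp (G : Eu d →L[ℝ] Eu d) :
    (G.adjoint ∘L G).toLinearMap.IsSymmetric := by
  intro x y
  simp [ContinuousLinearMap.adjoint_inner_left, ContinuousLinearMap.adjoint_inner_right]

/-- A function with zero differential on the connected domain `X` of an inverse chart is
constant. -/
lemma eq_of_mvfderiv_eq_zero {e : OpenPartialHomeomorph M (Eu d)}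
    (he : e ∈ IsManifold.maximalAtlas (𝓡 d) ∞ M) {X : Set (Eu d)} (hX : IsOpen X)
    (hXc : IsPreconnected X) (hXe : X ⊆ e.target) {f : M → ℝ}
    (hf : ∀ a ∈ X, MDifferentiableAt (𝓡 d) 𝓘(ℝ, ℝ) f (e.symm a))
    (hf' : ∀ a ∈ X, mvfderiv (𝓡 d) f (e.symm a) = 0) {a b : Eu d} (ha : a ∈ X) (hb : b ∈ X) :
    f (e.symm a) = f (e.symm b) := by
  have hsd : ∀ a ∈ X, MDifferentiableAt (𝓡 d) (𝓡 d) e.symm a := fun a ha =>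
    ((contMDiffOn_symm_of_mem_maximalAtlas he).contMDiffAt
      (e.open_target.mem_nhds (hXe ha))).mdifferentiableAt (by simp)
  refine hX.is_const_of_fderiv_eq_zero (𝕜 := ℝ) (f := f ∘ e.symm) hXc ?_ ?_ ha hb
  · intro a ha
    exact (MDifferentiableAt.comp a (hf a ha) (hsd a ha)).differentiableAt.differentiableWithinAt
  · intro a ha
    ext w
    have h1 := mvfderiv_comp_apply a (hf a ha) (hsd a ha) w
    rw [hf' a ha] at h1
    have h2 : mvfderiv (𝓡 d) (f ∘ e.symm) a w = fderiv ℝ (f ∘ e.symm) a w := by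
      simp only [mvfderiv, mfderiv_eq_fderiv]
      rfl
    rw [← h2, h1]
    rfl

end ParallelFrames

/-! ### Vanishing of the differential at a minimum -/

section MinimumDifferential

lemma mvfderiv_eq_zero_of_isMin {E H M : Type*} [NormedAddCommGroup E] [NormedSpace ℝ E]
    [TopologicalSpace H] {I : ModelWithCorners ℝ E H} [I.Boundaryless] [TopologicalSpace M]
    [ChartedSpace H M] {f : M → ℝ} {x : M} (hf : MDifferentiableAt I 𝓘(ℝ, ℝ) f x)
    (hmin : ∀ y, f x ≤ f y) : mvfderiv I f x = 0 := by
  rw [hf.mvfderiv, I.range_eq_univ, fderivWithin_univ]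
  refine IsLocalMin.fderiv_eq_zero (Eventually.of_forall fun y => ?_)
  simpa [writtenInExtChartAt, chartAt_self_eq] using hmin _

end MinimumDifferential

/-! ### Integration within one oriented chart -/

section SingleChart

variable {d : ℕ} {M : Type*} [TopologicalSpace M] [ChartedSpace (Eu d) M]
  {F : M → Type*} [TopologicalSpace (TotalSpace (Eu d) F)]
  [∀ x, AddCommGroup (F x)] [∀ x, Module ℝ (F x)] [∀ x, TopologicalSpace (F x)]
  [FiberBundle (Eu d) F]
  {oM : ManifoldOrientation d M} {oF : BundleOrientation d F}

/-- The integral of a form supported in a single oriented bundle chart. -/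
lemma OrientedBundleChart.hasFormIntegral (B : OrientedBundleChart oM oF) {η : TopForm d F}
    {A : Set M} (hA : IsOpen A) (hAB : A ⊆ B.chart.source)
    (hη : ∀ v : TotalSpace (Eu d) F, η v ≠ 0 → v.proj ∈ A)
    (hint : IntegrableOn (B.coeff η) ((B.chart '' A) ×ˢ univ)) :
    HasFormIntegral oM oF η (∫ z in (B.chart '' A) ×ˢ univ, B.coeff η z) := by
  refine ⟨fun _ => B, fun i => if i = 0 then A else ∅, fun i => ?_, fun i => ?_,
    fun i j hij => ?_, fun v hv => ⟨0, by simpa using hη v hv⟩, fun i => ?_, ?_, ?_⟩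
  · by_cases hi : i = 0
    · simpa [hi] using MeasurableSpace.measurableSet_generateFrom (s := {s : Set M | IsOpen s}) hA
    · simp [hi]
  · by_cases hi : i = 0 <;> simp [hi, hAB]
  · by_cases hi : i = 0
    · have hj : j ≠ 0 := fun h => hij (hi.trans h.symm)
      simp [hj]
    · simp [hi]
  · by_cases hi : i = 0 <;> simp [hi, hint]
  · refine summable_of_ne_finset_zero (s := {0}) fun i hi => ?_
    have hi' : i ≠ 0 := by simpa using hi
    simp [hi']
  · have h := hasSum_single (f := fun i : ℕ =>
      ∫ z in (B.chart '' (if i = 0 then A else ∅)) ×ˢ univ, B.coeff η z) 0 fun i hi => by simp [hi]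
    simpa using h

end SingleChart

/-! ### Assembling the local contribution -/

section LocalForm

variable {d : ℕ} {M : Type*} [TopologicalSpace M] [ChartedSpace (Eu d) M] [IsManifold (𝓡 d) ∞ M]
  {F : M → Type*} [TopologicalSpace (TotalSpace (Eu d) F)]
  [∀ x, AddCommGroup (F x)] [∀ x, Module ℝ (F x)] [∀ x, TopologicalSpace (F x)]
  [∀ x, IsTopologicalAddGroup (F x)] [∀ x, ContinuousSMul ℝ (F x)]
  [FiberBundle (Eu d) F] [VectorBundle ℝ (Eu d) F] [ContMDiffVectorBundle ∞ (Eu d) F (𝓡 d)]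
  {oM : ManifoldOrientation d M} {oF : BundleOrientation d F}
  {g : ContMDiffRiemannianMetric (𝓡 d) ∞ (Eu d) (fun x : M => TangentSpace (𝓡 d) x)}
  {cov : CovariantDerivative (𝓡 d) (Eu d) F} {N : ℕ}

/-- Outside `U α` the nonnegative function `ρ α` attains its minimum 0. -/
lemma TransversalCovering.dρ_eq_zero (C : TransversalCovering g cov N) {α : Fin N}
    {v : TotalSpace (Eu d) F} (hv : v.proj ∉ C.U α) : C.dρ α v = 0 := by
  have h := mvfderiv_eq_zero_of_isMin (C.mdifferentiableAt_ρ_proj α v) fun w => by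
    rw [C.ρ_eq_zero hv]
    exact C.ρ_nonneg α w.proj
  rw [TransversalCovering.dρ, h]
  rfl

/-- Outside `U (β i)` the column of `dρ_{β i}` is zero. Hence only the open corner is integrated
over, and the conventional values of `y` elsewhere play no role. -/
lemma TransversalCovering.mem_U_of_localForm_ne_zero (C : TransversalCovering g cov N)
    {α₁ : Fin N} {β : Fin d → Fin N} {φ : M → ℝ} {T : ℝ} {v : TotalSpace (Eu d) F}
    (hv : C.localForm α₁ β φ T v ≠ 0) (i : Fin d) : v.proj ∈ C.U (β i) := by
  by_contra h
  refine hv ?_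
  rw [TransversalCovering.localForm]
  convert! smul_zero _
  ext w
  refine Matrix.det_eq_zero_of_column_eq_zero (finProdFinEquiv (i, (0 : Fin 2))) fun j => ?_
  have h1 : (finProdFinEquiv (i, (0 : Fin 2))).divNat = i :=
    congrArg Prod.fst (finProdFinEquiv.symm_apply_apply (i, (0 : Fin 2)))
  have h2 : (finProdFinEquiv (i, (0 : Fin 2))).modNat = 0 :=
    congrArg Prod.snd (finProdFinEquiv.symm_apply_apply (i, (0 : Fin 2)))
  simp only [LinearMap.pi_apply, h1, h2, if_true, C.dρ_eq_zero h, smul_zero, LinearMap.zero_apply]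

lemma TransversalCovering.proj_mem_of_localForm_ne_zero (C : TransversalCovering g cov N)
    {α₁ : Fin N} {β : Fin d → Fin N} {φ : M → ℝ} {T : ℝ} {v : TotalSpace (Eu d) F}
    (hv : C.localForm α₁ β φ T v ≠ 0) : v.proj ∈ tsupport φ := by
  refine subset_tsupport φ fun h => hv ?_
  simp [TransversalCovering.localForm, h]

/-- Near a point of `U α` there are oriented coordinates whose frame is, up to signs, the given
parallel frame over `U α`. -/
lemma TransversalCovering.exists_orientedBundleChart (hd : 0 < d)
    (oM : ManifoldOrientation d M) (oF : BundleOrientation d F)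
    (C : TransversalCovering g cov N) {α : Fin N} {p : M} (hp : p ∈ C.U α) :
    ∃ (B : OrientedBundleChart oM oF) (w : Fin d → ℝ), (∀ i, w i ^ 2 = 1) ∧
      p ∈ B.chart.source ∧ B.chart.source ⊆ C.U α ∧
      B.frame = fun i x => w i • C.frame α i x := by
  obtain ⟨e, he, hpe, hpos⟩ := oM.exists_chart p
  obtain ⟨w, u, hw, hu, hpu, huU, hwpos⟩ := oF.exists_units_smul_positive hd
    (C.isLocalFrameOn α) (C.chart α).open_source hp
  have hsrc : (e.restr u).source = e.source ∩ u := e.restr_source' u hu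
  refine ⟨⟨e.restr u, restr_mem_maximalAtlas (contDiffGroupoid ∞ (𝓡 d)) he hu, ?_,
    fun i x => (w i : ℝ) • C.frame α i x, ?_, ?_⟩, fun i => w i, hw, ?_, ?_, rfl⟩
  · intro a ha
    have ha' : a ∈ e.target := by
      rw [OpenPartialHomeomorph.restr_target] at ha
      exact ha.1
    exact hpos a ha'
  · rw [hsrc]
    exact ((C.isLocalFrameOn α).units_smul w).mono (inter_subset_right.trans huU)
  · intro x hx
    rw [hsrc] at hx
    exact hwpos x hx.2
  · rw [hsrc]
    exact ⟨hpe, hpu⟩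
  · rw [hsrc]
    exact inter_subset_right.trans huU

/-- The sign changes made for orientation disappear on squaring, so the `α₁` Gaussian is the
standard one in the coordinates `y`. -/
lemma TransversalCovering.sum_sq_y_param (C : TransversalCovering g cov N) {α : Fin N}
    {B : OrientedBundleChart oM oF} {w : Fin d → ℝ} (hw : ∀ i, w i ^ 2 = 1)
    (hB : B.frame = fun i x => w i • C.frame α i x) {a : Eu d} (ha : B.chart.symm a ∈ C.U α)
    (y : Eu d) : ∑ j, C.y α j (B.param (a, y)) ^ 2 = ‖y‖ ^ 2 := by
  replace ha : B.chart.symm a ∈ (C.chart α).source := ha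
  have hc : ∀ j k, (C.isLocalFrameOn α).coeff j (B.chart.symm a) (C.frame α k (B.chart.symm a))
      = if k = j then 1 else 0 := by
    intro j k
    rw [IsLocalFrameOn.coeff_apply_of_mem (C.isLocalFrameOn α) ha]
    have : C.frame α k (B.chart.symm a) = (C.isLocalFrameOn α).toBasisAt ha k := by simp
    rw [this, Module.Basis.repr_self, Finsupp.single_apply]
  rw [EuclideanSpace.real_norm_sq_eq]
  refine Finset.sum_congr rfl fun j _ => ?_
  have h : C.y α j (B.param (a, y)) = y j * w j := by
    change (C.isLocalFrameOn α).coeff j (B.chart.symm a) (∑ k, y k • B.frame k (B.chart.symm a)) = _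
    rw [map_sum]
    simp [hB, hc]
  rw [h, mul_pow, hw, mul_one]

/-- Parallel frames are related by locally constant transition maps. -/
lemma TransversalCovering.exists_transition (C : TransversalCovering g cov N) {α β : Fin N}
    {B : OrientedBundleChart oM oF} {w : Fin d → ℝ}
    (hB : B.frame = fun i x => w i • C.frame α i x) (hα : B.chart.source ⊆ C.U α)
    {X : Set (Eu d)} (hX : IsOpen X)
    (hXc : IsPreconnected X) (hXn : X.Nonempty) (hXe : X ⊆ B.chart.target)
    (hXβ : ∀ a ∈ X, B.chart.symm a ∈ C.U β) :
    ∃ G : Eu d →L[ℝ] Eu d, Function.Injective G ∧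
      ∀ a ∈ X, ∀ y j, C.y β j (B.param (a, y)) = G y j := by
  obtain ⟨a₀, ha₀⟩ := hXn
  have hcov : ∀ k, ∀ x ∈ B.chart.source, cov (B.frame k) x = 0 := by
    intro k x hx
    have h1 : MDifferentiableAt (𝓡 d) ((𝓡 d).prod 𝓘(ℝ, Eu d))
        (fun x => TotalSpace.mk' (Eu d) x (C.frame α k x)) x :=
      ((C.isLocalFrameOn α).contMDiffAt (C.chart α).open_source (hα hx) k).mdifferentiableAt
        (by simp)
    have h2 := cov.isCovariantDerivativeOnUniv.smul_const (w k) h1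
    rw [C.parallel α k x (hα hx), smul_zero] at h2
    rw [hB]
    exact h2
  have hconst : ∀ a ∈ X, ∀ j k, (C.isLocalFrameOn β).coeff j _ (B.frame k (B.chart.symm a))
      = (C.isLocalFrameOn β).coeff j _ (B.frame k (B.chart.symm a₀)) := by
    intro a ha j k
    have hs : ∀ b ∈ X, ContMDiffAt (𝓡 d) ((𝓡 d).prod 𝓘(ℝ, Eu d)) ∞
        (fun x => TotalSpace.mk' (Eu d) x (B.frame k x)) (B.chart.symm b) := fun b hb =>
      B.isLocalFrameOn.contMDiffAt B.chart.open_source (B.chart.map_target (hXe hb)) k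
    refine eq_of_mvfderiv_eq_zero (f := fun x => (C.isLocalFrameOn β).coeff j x (B.frame k x))
      B.chart_mem hX hXc hXe (fun b hb => ?_) (fun b hb => ?_) ha ha₀
    · exact (contMDiffAt_frame_coeff_section (C.isLocalFrameOn β) (C.chart β).open_source
        (hXβ b hb) (hs b hb) j).mdifferentiableAt (by simp)
    · exact cov.mvfderiv_coeff_eq_zero (C.isLocalFrameOn β) (C.chart β).open_source
        (hXβ b hb) (fun i => C.parallel β i _ (hXβ b hb)) (hs b hb)
        (hcov k _ (B.chart.map_target (hXe hb))) j
  refine ⟨frameTransition (C.isLocalFrameOn β) B.frame (B.chart.symm a₀),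
    injective_frameTransition _ B.isLocalFrameOn (hXβ a₀ ha₀) (B.chart.map_target (hXe ha₀)), ?_⟩
  intro a ha y j
  rw [frameTransition_apply]
  change (C.isLocalFrameOn β).coeff j (B.chart.symm a) (∑ k, y k • B.frame k (B.chart.symm a)) = _
  rw [map_sum, map_sum]
  exact Finset.sum_congr rfl fun k _ => by rw [map_smul, map_smul, hconst a ha j k]

/-- The local contribution of a vertex, for a bundle of any positive rank `d`. -/
theorem TransversalCovering.exists_tendsto_integral_localForm [CompactSpace M] (hd : 0 < d)
    (oM : ManifoldOrientation d M) (oF : BundleOrientation d F)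
    (C : TransversalCovering g cov N) {W : Set M} (hW : IsOpen W) {p : M} (hpW : p ∈ W)
    {α₁ : Fin N} (hα₁ : p ∈ C.U α₁) {β : Fin d → Fin N} (hβ : Function.Injective β)
    (hβp : range β = {α | p ∈ frontier (C.U α)}) (hαβ : ∀ i, α₁ < β i) :
    ∃ V : Set M, IsOpen V ∧ p ∈ V ∧ V ⊆ W ∧
      ∃ ν : ℝ, ∀ φ : M → ℝ, ContMDiff (𝓡 d) 𝓘(ℝ, ℝ) ∞ φ → tsupport φ ⊆ V →
        (∀ᶠ x in 𝓝 p, φ x = 1) →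
        ∃ J : ℝ → ℝ, (∀ T : ℝ, 0 < T → HasFormIntegral oM oF (C.localForm α₁ β φ T) (J T)) ∧
          Tendsto J atTop (𝓝 ν) := by
  obtain ⟨B, w, hw, hpB, hBU, hB⟩ := C.exists_orientedBundleChart hd oM oF hα₁
  obtain ⟨V, hV, hpV, hVsub, hcorner⟩ :=
    C.exists_isCornerChart hβ hβp B.chart_mem hpB hW hpW
  refine ⟨V, hV, hpV, hVsub.trans inter_subset_left, ?_⟩
  set A : Set M := V ∩ {x | ∀ i, x ∈ C.U (β i)} with hA
  set X : Set (Eu d) := B.chart '' A with hX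
  set P : Eu d → Eu d := fun b => WithLp.toLp 2 fun i => C.ρ (β i) (B.chart.symm b) with hP
  have hAsrc : A ⊆ B.chart.source := fun x hx => (hVsub hx.1).2
  have hAo : IsOpen A := by
    refine hV.inter ?_
    rw [ofPred_forall]
    exact isOpen_iInter_of_finite fun i => (C.chart (β i)).open_source
  have hXA : ∀ a ∈ X, B.chart.symm a ∈ A := by
    rintro _ ⟨x, hx, rfl⟩
    rwa [B.chart.left_inv (hAsrc hx)]
  have hXe : X ⊆ B.chart.target := by
    rintro _ ⟨x, hx, rfl⟩
    exact B.chart.map_source (hAsrc hx)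
  -- Connectedness of `X` gives one map `G i` valid over the whole corner.
  have hG := fun i => C.exists_transition (β := β i) hB hBU hcorner.isOpen
    hcorner.isPreconnected hcorner.nonempty hXe fun a ha => (hXA a ha).2 i
  choose G hGinj hG using hG
  obtain ⟨c, hc0, hc⟩ := exists_lower_bound_adjoint_comp hGinj
  obtain ⟨ε, hε⟩ := hcorner.exists_sign
  obtain ⟨κ, hκ⟩ := exists_coeff_localForm_eq d
  -- The value is built from transition maps and an orientation sign, and is chosen before `φ`.
  refine ⟨κ * ε * ∫ t in posOrthant d,
    gaussianTransform (fun i => (G i).adjoint ∘L G i) (euclideanDet d) t, fun φ hφ hφV hφ1 => ?_⟩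
  obtain ⟨Cφ, hCφ⟩ := isCompact_univ.exists_bound_of_continuousOn hφ.continuous.continuousOn
  have hφX : ContinuousOn (fun a => φ (B.chart.symm a)) X :=
    hφ.continuous.comp_continuousOn (B.chart.continuousOn_symm.mono hXe)
  have hφ1' : {a | φ (B.chart.symm a) = 1} ∈ 𝓝 (B.chart p) := by
    have h := (B.chart.continuousAt_symm (B.chart.map_source hpB)).tendsto
    rw [B.chart.left_inv hpB] at h
    exact h.eventually hφ1
  obtain ⟨hint, hlim⟩ := tendsto_integral_gaussian_family
    (S := fun i => (G i).adjoint ∘L G i) (Ω := euclideanDet d) (X := X) (P := P)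
    (P' := fun a => fderiv ℝ P a) (χ := fun a => φ (B.chart.symm a)) (Cχ := Cφ)
    (m := (α₁ : ℕ) + 1) (b := fun i => (β i : ℕ) + 1)
    (f := fun T => B.coeff (C.localForm α₁ β φ T))
    (fun i => isSymmetric_adjoint_comp (G i)) hc0 hc hcorner.isOpen.measurableSet
    (fun a ha => (hcorner.differentiableAt a ha).hasFDerivAt.hasFDerivWithinAt) hcorner.injOn
    hcorner.mem_posOrthant hcorner.volume_image_ne_top hε
    (hφX.aestronglyMeasurable hcorner.isOpen.measurableSet) (fun a _ => hCφ _ (mem_univ _))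
    (hcorner.eventually_exists _ hφ1')
    -- The shift by one comes from counting powers of `T` from 1; the strict order of indices gives
    -- positive scaling exponents.
    (fun i => Nat.succ_lt_succ (hαβ i)) κ
    (fun T _ a ha y => hκ B C α₁ β φ T a (hXe ha) (fun i => (hXA a ha).2 i) G
      (fun i y j => hG i a ha y j)
      (fun y => C.sum_sq_y_param hw hB (hBU (B.chart.map_target (hXe ha))) y) P (fun b i => rfl)
      _ (hcorner.differentiableAt a ha).hasFDerivAt y)
  refine ⟨_, fun T hT => B.hasFormIntegral hAo hAsrc (fun v hv => ?_) (hint T hT), hlim⟩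
  exact ⟨hφV (C.proj_mem_of_localForm_ne_zero hv), C.mem_U_of_localForm_ne_zero hv⟩

end LocalForm

theorem propositiont0p1 {n : ℕ} (hn : 1 ≤ n)
    {M : Type*} [TopologicalSpace M] [T2Space M] [CompactSpace M]
    [ChartedSpace (Eu (2 * n)) M] [IsManifold (𝓡 (2 * n)) ∞ M]
    {F : M → Type*} [TopologicalSpace (TotalSpace (Eu (2 * n)) F)]
    [∀ x, AddCommGroup (F x)] [∀ x, Module ℝ (F x)] [∀ x, TopologicalSpace (F x)]
    [∀ x, IsTopologicalAddGroup (F x)] [∀ x, ContinuousSMul ℝ (F x)]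
    [FiberBundle (Eu (2 * n)) F] [VectorBundle ℝ (Eu (2 * n)) F]
    [ContMDiffVectorBundle ∞ (Eu (2 * n)) F (𝓡 (2 * n))]
    (oM : ManifoldOrientation (2 * n) M) (oF : BundleOrientation (2 * n) F)
    (g : ContMDiffRiemannianMetric (𝓡 (2 * n)) ∞ (Eu (2 * n))
      (fun x : M => TangentSpace (𝓡 (2 * n)) x))
    (cov : CovariantDerivative (𝓡 (2 * n)) (Eu (2 * n)) F)
    {N : ℕ} (C : TransversalCovering g cov N)
    (W : M → Set M) (hW : C.IsVertexNeighborhoods W)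
    (p : M) (hp : p ∈ C.Bplus)
    (α₁ : Fin N) (hα₁ : IsGreatest {α | p ∈ C.U α} α₁)
    (β : Fin (2 * n) → Fin N) (hβ : StrictAnti β)
    (hβp : Set.range β = {α | p ∈ frontier (C.U α)}) :
    ∃ V : Set M, IsOpen V ∧ p ∈ V ∧ V ⊆ W p ∧
      ∃ ν : ℝ, ∀ φ : M → ℝ, ContMDiff (𝓡 (2 * n)) 𝓘(ℝ, ℝ) ∞ φ → tsupport φ ⊆ V →
        (∀ᶠ x in 𝓝 p, φ x = 1) →
        ∃ J : ℝ → ℝ, (∀ T : ℝ, 0 < T → HasFormIntegral oM oF (C.localForm α₁ β φ T) (J T)) ∧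
          Tendsto J atTop (𝓝 ν) :=
  C.exists_tendsto_integral_localForm (by omega) oM oF (hW.isOpen p hp.1) (hW.mem p hp.1) hα₁.1
    hβ.injective hβp fun i =>
      hp.2 α₁ (β i) hα₁.1 (hβp ▸ mem_range_self i : β i ∈ {α | p ∈ frontier (C.U α)})
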